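/- **Notation.** Write a quaternion as $q=a+bj$ with $a,b\in\mathbb{C}$ and $j$ the third quaternionic basis element ($j^2=-1$, $ja=\bar a j$); it is represented by the matrix $\begin{pmatrix} a & ib\\ i\bar b&\bar a\end{pmatrix}$. The elementwise product is $(a+bj)\cdot(c+dj)=ac+bd\,j$. Let $\mathbb{H}_+=\{z+sj: z\in\mathbb{C},\ s\in\mathbb{R},\ s>0\}$. For a complex $N\times N$ matrix $X$ let $\mathbf{X}$ be the $2N\times2N$ matrix whose $(i,j)$ block is $\begin{pmatrix} X_{ij}&0\\0&\overline{X_{ji}}\end{pmatrix}$. For $q\in\mathbb{H}_+$ with matrix representation $\mathbf{q}$, let $\mathbf{R}=(\mathbf{X}-\mathbf{q})^{-1}$, where $\mathbf{q}$ is subtracted from every diagonal block. The quaternionic Green's function $\mathcal{G}(q;X)$ is the quaternion whose matrix representation is the mean $\frac1N\sum_{i=1}^N\mathbf{R}_{ii}$ of the diagonal $2\times2$ blocks of $\mathbf{R}$. **Theorem (Sum Rule).** Let $\{\xi_{ij}\}_{i,j\ge1}$ be complex random variables on one probability space such that - $\mathbb{E}\,\xi_{ij}=0$ and $\mathbb{E}|\xi_{ij}|^2=1$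 for all $i,j$; - $\mathbb{E}|\xi_{ij}|^3<C$ for all $i,j$, for some finite constant $C$; - the pairs $(\xi_{ij},\xi_{ji})$, $i\le j$, are independent of one another, and $\mathbb{E}\,\xi_{ij}\xi_{ji}=\tau$ for all $i\ne j$, where $\tau\in[0,1]$. Let $A_N=(\xi_{ij}/\sqrt N)_{i,j=1}^N$. Let $D_N$ be deterministic complex $N\times N$ matrices such that $\mathcal{G}(p;D_N)\to\mathcal{G}_D(p)$ as $N\to\infty$ for every $p\in\mathbb{H}_+$. Put $t=\tau+j$ and fix $q=\lambda+\varepsilon j$ with $\lambda\in\mathbb{C}$ and $\varepsilon>1$ real. Then there is exactly one quaternion $\mathcal{G}(q)$ with $q+t\cdot\mathcal{G}(q)\in\mathbb{H}_+$ and $$\mathcal{G}(q)=\mathcal{G}_D\big(q+t\cdot\mathcal{G}(q)\big),$$ and $\mathcal{G}(q;D_N+A_N)\to\mathcal{G}(q)$ in probability as $N\to\infty$. -/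

import Mathlib

open MeasureTheory ProbabilityTheory Filter Topology
open scoped Quaternion Kronecker

namespace QuatGreen

noncomputable section

/-- The quaternion `a + b j` built from two complex numbers `a`, `b`. -/
def quat (a b : ℂ) : ℍ[ℝ] := ⟨a.re, a.im, b.re, b.im⟩

/-- The complex part `a` of the quaternion `a + b j`. -/
def cpart (q : ℍ[ℝ]) : ℂ := ⟨q.re, q.imI⟩

/-- The hypercomplex part `b` of the quaternion `a + b j`. -/
def jpart (q : ℍ[ℝ]) : ℂ := ⟨q.imJ, q.imK⟩

/-- `quat a b` is `a + b * j` in Hamilton's quaternions, with `j = quat 0 1 = ⟨0, 0, 1, 0⟩`. -/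
theorem quat_eq (a b : ℂ) : quat a b = (a : ℍ[ℝ]) + (b : ℍ[ℝ]) * quat 0 1 := by
  obtain ⟨h1, h2, h3, h4⟩ : (quat 0 1).re = 0 ∧ (quat 0 1).imI = 0 ∧ (quat 0 1).imJ = 1 ∧
      (quat 0 1).imK = 0 := ⟨rfl, rfl, rfl, rfl⟩
  ext
  · simp [h1, h2, h3, h4]; rfl
  · simp [h1, h2, h3, h4]; rfl
  · simp [h1, h2, h3, h4]; rfl
  · simp [h1, h2, h3, h4]; rfl

/-- The elementwise product `(a + b j) · (c + d j) = a c + b d j`. -/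
def elemMul (p q : ℍ[ℝ]) : ℍ[ℝ] := quat (cpart p * cpart q) (jpart p * jpart q)

/-- The `2 × 2` complex matrix representing the quaternion `q = a + b j`. -/
def toMat (q : ℍ[ℝ]) : Matrix (Fin 2) (Fin 2) ℂ :=
  !![cpart q, Complex.I * jpart q;
    Complex.I * (starRingEnd ℂ) (jpart q), (starRingEnd ℂ) (cpart q)]

/-- The half-space of the quaternions `z + s j` with `z` complex and `s` real, `s > 0`: the
domain of quaternionic Green's functions. -/
def halfSpace : Set ℍ[ℝ] := {p | ∃ (z : ℂ) (s : ℝ), 0 < s ∧ p = quat z (s : ℂ)}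

/-- The doubled matrix, whose `(i, j)` block of size `2 × 2` is `diag (X i j, conj (X j i))`. The
index `(i, s)` is row or column `s` within block `i`. -/
def bold {N : ℕ} (X : Matrix (Fin N) (Fin N) ℂ) :
    Matrix (Fin N × Fin 2) (Fin N × Fin 2) ℂ :=
  Matrix.of fun x y => !![X x.1 y.1, 0; 0, (starRingEnd ℂ) (X y.1 x.1)] x.2 y.2

/-- The doubled matrix minus the quaternion `q` (one copy of `q` in each diagonal block). -/
def shifted {N : ℕ} (q : ℍ[ℝ]) (X : Matrix (Fin N) (Fin N) ℂ) :
    Matrix (Fin N × Fin 2) (Fin N × Fin 2) ℂ :=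
  bold X - (1 : Matrix (Fin N) (Fin N) ℂ) ⊗ₖ toMat q

/-- The `2N × 2N` resolvent of `X` at the quaternion `q`. -/
def resolvent {N : ℕ} (q : ℍ[ℝ]) (X : Matrix (Fin N) (Fin N) ℂ) :
    Matrix (Fin N × Fin 2) (Fin N × Fin 2) ℂ :=
  (shifted q X)⁻¹

/-- The average of the `N` diagonal `2 × 2` blocks of the resolvent. -/
def greenMat {N : ℕ} (q : ℍ[ℝ]) (X : Matrix (Fin N) (Fin N) ℂ) : Matrix (Fin 2) (Fin 2) ℂ :=
  (N : ℂ)⁻¹ • ∑ i : Fin N, Matrix.of fun s t => resolvent q X (i, s) (i, t)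

/-- The quaternionic Green's function of `X` at `q`: the quaternion whose matrix representation is
`greenMat q X`, read off from the first row of that matrix (see `toMat_green`). -/
def green {N : ℕ} (q : ℍ[ℝ]) (X : Matrix (Fin N) (Fin N) ℂ) : ℍ[ℝ] :=
  quat (greenMat q X 0 0) (-Complex.I * greenMat q X 0 1)

/-- On the half-space, `green q X` is the quaternion with matrix representation `greenMat q X`. -/
theorem toMat_green {N : ℕ} {q : ℍ[ℝ]} (hq : q ∈ halfSpace) (X : Matrix (Fin N) (Fin N) ℂ) :
    toMat (green q X) = greenMat q X := by
  obtain ⟨z, s, hs, rfl⟩ := hq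
  obtain ⟨h00, h01, h10⟩ : greenMat (quat z s) X 1 1 = (starRingEnd ℂ) (greenMat (quat z s) X 0 0) ∧
      greenMat (quat z s) X 0 1 = -(starRingEnd ℂ) (greenMat (quat z s) X 0 1) ∧
      greenMat (quat z s) X 1 0 = greenMat (quat z s) X 0 1 := by
    by_cases hu : IsUnit (shifted (quat z s) X).det
    swap
    · have : resolvent (quat z s) X = 0 := Matrix.nonsing_inv_apply_not_isUnit _ hu
      simp [greenMat, this]
    have hR1 : shifted (quat z s) X * resolvent (quat z s) X = 1 := Matrix.mul_nonsing_inv _ hu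
    have hR2 : resolvent (quat z s) X * shifted (quat z s) X = 1 := Matrix.nonsing_inv_mul _ hu
    set M := shifted (quat z s) X with hM
    set R := resolvent (quat z s) X with hR
    set W : Matrix (Fin N × Fin 2) (Fin N × Fin 2) ℂ :=
      Matrix.of fun x y => if x.1 = y.1 then !![(0 : ℂ), 1; -1, 0] x.2 y.2 else 0 with hW
    have hMW : M * W = W * M.conjTranspose := by
      ext ⟨i, a⟩ ⟨j, b⟩
      fin_cases a <;> fin_cases b <;> by_cases hij : i = j <;>
        simp [hM, hW, shifted, bold, toMat, cpart, jpart, quat, Matrix.mul_apply,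
          Fintype.sum_prod_type, Matrix.one_apply, hij, Complex.ext_iff, eq_comm]
    have hRW : W * R.conjTranspose = R * W := by
      have h1 : M.conjTranspose * R.conjTranspose = 1 := by
        rw [← Matrix.conjTranspose_mul, hR2, Matrix.conjTranspose_one]
      calc W * R.conjTranspose = (R * M) * W * R.conjTranspose := by rw [hR2, one_mul]
        _ = R * (M * W) * R.conjTranspose := by simp only [Matrix.mul_assoc]
        _ = R * W * (M.conjTranspose * R.conjTranspose) := by
          rw [hMW]; simp only [Matrix.mul_assoc]
        _ = R * W := by rw [h1, mul_one]
    have e (i : Fin N) (a b : Fin 2) := congrFun (congrFun hRW (i, a)) (i, b)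
    have e00 : ∀ i, R (i, 1) (i, 1) = (starRingEnd ℂ) (R (i, 0) (i, 0)) := fun i => by
      have := e i 1 0
      simpa [hW, Matrix.mul_apply, Fintype.sum_prod_type, eq_comm] using this
    have e01 : ∀ i, R (i, 0) (i, 1) = -(starRingEnd ℂ) (R (i, 0) (i, 1)) := fun i => by
      have := e i 0 0
      simp [hW, Matrix.mul_apply, Fintype.sum_prod_type] at this
      rw [this, neg_neg]
    refine ⟨?_, ?_, ?_⟩
    · simp [greenMat, Matrix.sum_apply, ← hR, e00]
    · simp only [greenMat, Matrix.smul_apply, Matrix.sum_apply, ← hR, Matrix.of_apply, smul_eq_mul,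
        map_mul, map_inv₀, map_natCast, map_sum]
      rw [← mul_neg, ← Finset.sum_neg_distrib]
      congr 1
      exact Finset.sum_congr rfl fun i _ => e01 i
    · have t1 : ∑ i, (M * R) (i, 0) (i, 0) = ∑ i, (R * M) (i, 0) (i, 0) := by rw [hR1, hR2]
      have hs' : (s : ℂ) ≠ 0 := by exact_mod_cast hs.ne'
      simp [hM, shifted, bold, toMat, cpart, jpart, quat, Matrix.mul_apply,
        Fintype.sum_prod_type, Matrix.one_apply, Finset.sum_add_distrib] at t1
      have hc : (⟨s, 0⟩ : ℂ) = (s : ℂ) := rfl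
      rw [Finset.sum_comm, hc, Complex.conj_ofReal, ← Finset.mul_sum, ← Finset.sum_mul] at t1
      have t2 : ∑ x, R (x, 1) (x, 0) = ∑ x, R (x, 0) (x, 1) := by
        have hA : ∑ y, ∑ x, (X x y - if x = y then z else 0) * R (y, 0) (x, 0) =
            ∑ x, ∑ y, R (x, 0) (y, 0) * (X y x - if y = x then z else 0) :=
          Finset.sum_congr rfl fun _ _ => Finset.sum_congr rfl fun _ _ => mul_comm _ _
        rw [hA] at t1
        have t3 := neg_injective (add_left_cancel t1)
        rw [mul_comm] at t3
        exact mul_right_cancel₀ (mul_ne_zero Complex.I_ne_zero hs') t3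
      simp [greenMat, Matrix.sum_apply, ← hR, t2]
  have hI : Complex.I * (-Complex.I * greenMat (quat z s) X 0 1) = greenMat (quat z s) X 0 1 := by
    rw [← mul_assoc, mul_neg, Complex.I_mul_I]; simp
  ext a b
  fin_cases a <;> fin_cases b
  · simp [toMat, green, cpart, quat]
  · exact hI
  · have : toMat (green (quat z s) X) 1 0 =
        Complex.I * (starRingEnd ℂ) (-Complex.I * greenMat (quat z s) X 0 1) := rfl
    simp only [Fin.zero_eta, Fin.mk_one, this, h10, map_mul, map_neg, Complex.conj_I, neg_neg]
    rw [← mul_assoc, Complex.I_mul_I, neg_one_mul, ← h01]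
  · have : toMat (green (quat z s) X) 1 1 =
        (starRingEnd ℂ) (greenMat (quat z s) X 0 0) := rfl
    simp only [Fin.mk_one, this, h00]

/-- The normalised `N × N` matrix with entries `ξ i j / √N`. -/
def normalised (N : ℕ) (ξ : ℕ → ℕ → ℂ) : Matrix (Fin N) (Fin N) ℂ :=
  Matrix.of fun i j => ξ i j / (Real.sqrt N : ℂ)

end

end QuatGreen

/-! Write `M` for the shifted doubled matrix at `z + s j` and `B = bold (X - z)`. The cross terms in
`Mᴴ M` cancel, so `Mᴴ M = Bᴴ B + s²` and the resolvent has norm at most `1 / s`, whatever `X` is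
(`norm_resolvent_le`). The resolvent identity then gives `‖G(p) - G(p')‖ ≤ ‖p - p'‖ / (s s')` for
Green's functions. Their j-part is real and nonnegative (`exists_jpart_green`). Both facts pass to
the limit `GD`. Adding `t · g` therefore never lowers the j-part below `ε`, and `g ↦ GD (q + t · g)`
contracts a closed half-space by `1 / ε² < 1`; Banach's theorem yields the solution `g` and its
uniqueness (`exists_unique_selfConsistent`).

For convergence, let `R`, `G` belong to `D + A` at `q`, and `R₀` to `D` at `q + t · g`. The
resolvent identity reads `G_D(q + t · g) - G = Δ + avg (R₀ (t · (g - G)) R)` with `Δ = avg (R₀ (𝐀 +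
t · G) R)`. The last average is at most `‖g - G‖ / ε²`, so it can be absorbed (`norm_green_sub_le`),
and it suffices that the discrepancy `Δ` tends to zero in probability.

This follows from a second moment. `N E|Δ_ab|²` is a sum over index pairs `(i, j)` of terms `E[A_ij
S_ji conj Δ_ab]`, each with its share of the counterterm `t · G` (`natCast_mul_discrepancy`). Off
the diagonal, everything is expanded around the matrix with entries `(i, j)` and `(j, i)` deleted,
which is independent of those two entries. The first-order term vanishes by centring. The
covariances of opposite positions, `τ / N` and `1 / N`, cancel the counterterm: this is why `t = τ +
j`. The other covariances multiply products `R_ji S_ji`, whose sum over all `i, j` is only `O(N)` by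
a Hilbert–Schmidt bound. Third moments make the remainder `O(N^(-3/2))` for each pair. Hence
`E|Δ_ab|² = O(N^(-1/2))` (`integral_norm_sq_discrepancy_le`), and Markov's inequality concludes. -/

namespace QuatGreen

open Matrix
open scoped Matrix.Norms.L2Operator

/-! ### Operator norm estimates for entries, columns and submatrices -/

section OperatorNorm

variable {m n : Type*} [Fintype m] [Fintype n] [DecidableEq m] [DecidableEq n]

omit [DecidableEq m] in
lemma sum_sq_norm_col_le (B : Matrix m n ℂ) (y : n) : ∑ x, ‖B x y‖ ^ 2 ≤ ‖B‖ ^ 2 := by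
  have h := l2_opNorm_mulVec B (EuclideanSpace.single y (1 : ℂ))
  rw [PiLp.norm_single, norm_one, mul_one] at h
  have h2 := pow_le_pow_left₀ (norm_nonneg _) h 2
  rw [EuclideanSpace.norm_sq_eq] at h2
  simpa [Matrix.mulVec_single] using h2

omit [DecidableEq m] in
lemma norm_entry_le (B : Matrix m n ℂ) (x : m) (y : n) : ‖B x y‖ ≤ ‖B‖ := by
  have h := (Finset.single_le_sum (f := fun x => ‖B x y‖ ^ 2) (fun _ _ => by positivity)
    (Finset.mem_univ x)).trans (sum_sq_norm_col_le B y)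
  exact (pow_le_pow_iff_left₀ (norm_nonneg _) (norm_nonneg _) two_ne_zero).1 h

lemma norm_single_le (x : m) (y : n) (c : ℂ) : ‖(Matrix.single x y c : Matrix m n ℂ)‖ ≤ ‖c‖ := by
  have h : (Matrix.single x y c)ᴴ * Matrix.single x y c =
      Matrix.diagonal (Pi.single y (star c * c)) := by
    rw [Matrix.conjTranspose_single, Matrix.single_mul_single_same, Matrix.diagonal_single]
  have h2 := l2_opNorm_conjTranspose_mul_self (Matrix.single x y c)
  rw [h, l2_opNorm_diagonal, Pi.norm_single] at h2
  rw [norm_mul, norm_star] at h2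
  nlinarith [norm_nonneg c, norm_nonneg (Matrix.single x y c : Matrix m n ℂ)]

lemma norm_le_sum_norm (B : Matrix m n ℂ) : ‖B‖ ≤ ∑ x, ∑ y, ‖B x y‖ := by
  conv_lhs => rw [Matrix.matrix_eq_sum_single B]
  refine (norm_sum_le _ _).trans (Finset.sum_le_sum fun x _ => ?_)
  exact (norm_sum_le _ _).trans (Finset.sum_le_sum fun y _ => norm_single_le _ _ _)

omit [DecidableEq m] in
-- The C*-identity for a multiple of an isometry. Quaternion matrices are of this kind, so `toMat`
-- preserves norms.
lemma norm_eq_of_conjTranspose_mul_self [Nonempty n] {B : Matrix m n ℂ} {c : ℝ} (hc : 0 ≤ c)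
    (h : Bᴴ * B = ((c ^ 2 : ℝ) : ℂ) • 1) : ‖B‖ = c := by
  have h2 := l2_opNorm_conjTranspose_mul_self B
  have h1 : ‖(1 : Matrix n n ℂ)‖ = 1 := by
    rw [← Matrix.diagonal_one, l2_opNorm_diagonal]; simp
  rw [h, norm_smul, h1, Complex.norm_real, Real.norm_of_nonneg (by positivity), mul_one, sq] at h2
  exact ((mul_self_inj hc (norm_nonneg _)).1 h2).symm

lemma norm_one_submatrix_le {f : m → n} (hf : f.Injective) :
    ‖((1 : Matrix n n ℂ).submatrix id f)‖ ≤ 1 := by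
  have h2 := l2_opNorm_conjTranspose_mul_self ((1 : Matrix n n ℂ).submatrix id f)
  have h3 : ((1 : Matrix n n ℂ).submatrix id f)ᴴ * ((1 : Matrix n n ℂ).submatrix id f) = 1 := by
    ext x y
    simp [Matrix.mul_apply, Matrix.one_apply, hf.eq_iff]
  have h1 : ‖(1 : Matrix m m ℂ)‖ ≤ 1 := by
    rw [← Matrix.diagonal_one, l2_opNorm_diagonal]
    exact (pi_norm_le_iff_of_nonneg zero_le_one).2 fun _ => by simp
  rw [h3] at h2
  nlinarith [norm_nonneg ((1 : Matrix n n ℂ).submatrix id f)]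

lemma norm_submatrix_le {k l : Type*} [Fintype k] [Fintype l] [DecidableEq k] [DecidableEq l]
    (B : Matrix m n ℂ) {f : k → m} {g : l → n} (hf : f.Injective) (hg : g.Injective) :
    ‖B.submatrix f g‖ ≤ ‖B‖ := by
  have e : B.submatrix f g =
      ((1 : Matrix m m ℂ).submatrix id f)ᴴ * B * ((1 : Matrix n n ℂ).submatrix id g) := by
    ext x y
    simp [Matrix.mul_apply, Matrix.one_apply]
  rw [e]
  refine (l2_opNorm_mul _ _).trans ?_
  refine (mul_le_mul (l2_opNorm_mul _ _) (norm_one_submatrix_le hg) (norm_nonneg _)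
    (by positivity)).trans ?_
  rw [l2_opNorm_conjTranspose, mul_one]
  exact mul_le_of_le_one_left (norm_nonneg _) (norm_one_submatrix_le hf)

end OperatorNorm

/-! ### Norms and elementwise products of quaternions -/

section Quaternions

@[simp] lemma cpart_quat (a b : ℂ) : cpart (quat a b) = a := rfl
@[simp] lemma jpart_quat (a b : ℂ) : jpart (quat a b) = b := rfl
@[simp] lemma cpart_sub (p q : ℍ[ℝ]) : cpart (p - q) = cpart p - cpart q := rfl
@[simp] lemma jpart_sub (p q : ℍ[ℝ]) : jpart (p - q) = jpart p - jpart q := rfl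
@[simp] lemma cpart_add (p q : ℍ[ℝ]) : cpart (p + q) = cpart p + cpart q := rfl
@[simp] lemma jpart_add (p q : ℍ[ℝ]) : jpart (p + q) = jpart p + jpart q := rfl

lemma norm_sq_eq_parts (q : ℍ[ℝ]) : ‖q‖ ^ 2 = ‖cpart q‖ ^ 2 + ‖jpart q‖ ^ 2 := by
  rw [← Quaternion.normSq_eq_norm_mul_self q |>.trans (sq _).symm, Quaternion.normSq_def']
  rw [← Complex.normSq_eq_norm_sq, ← Complex.normSq_eq_norm_sq, Complex.normSq_apply,
    Complex.normSq_apply]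
  simp only [cpart, jpart]
  ring

lemma toMat_sub (p q : ℍ[ℝ]) : toMat (p - q) = toMat p - toMat q := by
  ext a b
  fin_cases a <;> fin_cases b <;> simp [toMat, mul_sub]

lemma toMat_add (p q : ℍ[ℝ]) : toMat (p + q) = toMat p + toMat q := by
  ext a b
  fin_cases a <;> fin_cases b <;> simp [toMat, mul_add]

lemma toMat_conjTranspose_mul_self (q : ℍ[ℝ]) :
    (toMat q)ᴴ * toMat q = ((‖q‖ ^ 2 : ℝ) : ℂ) • 1 := by
  have h1 := Complex.conj_mul' (cpart q)
  have h2 := Complex.conj_mul' (jpart q)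
  rw [norm_sq_eq_parts]
  ext a b
  fin_cases a <;> fin_cases b <;>
    simp [toMat, Matrix.mul_apply, ← h1, ← h2] <;> ring_nf <;> simp

lemma norm_toMat (q : ℍ[ℝ]) : ‖toMat q‖ = ‖q‖ :=
  norm_eq_of_conjTranspose_mul_self (norm_nonneg _) (toMat_conjTranspose_mul_self q)

lemma norm_one_kronecker_toMat_le (N : ℕ) (q : ℍ[ℝ]) :
    ‖(1 : Matrix (Fin N) (Fin N) ℂ) ⊗ₖ toMat q‖ ≤ ‖q‖ := by
  cases N with
  | zero =>
    have : (1 : Matrix (Fin 0) (Fin 0) ℂ) ⊗ₖ toMat q = 0 := by ext ⟨i, _⟩; exact i.elim0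
    rw [this, norm_zero]; positivity
  | succ N =>
    refine (norm_eq_of_conjTranspose_mul_self (norm_nonneg _) ?_).le
    rw [Matrix.conjTranspose_kronecker, ← Matrix.mul_kronecker_mul, toMat_conjTranspose_mul_self,
      Matrix.conjTranspose_one, one_mul, Matrix.kronecker_smul, Matrix.one_kronecker_one]

/-- The two complex parts are scaled by `τ` and `1`, neither of which exceeds one. -/
lemma norm_elemMul_le {τ : ℝ} (hτ0 : 0 ≤ τ) (hτ1 : τ ≤ 1) (q : ℍ[ℝ]) :
    ‖elemMul (quat τ 1) q‖ ≤ ‖q‖ := by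
  refine (pow_le_pow_iff_left₀ (norm_nonneg _) (norm_nonneg _) two_ne_zero).1 ?_
  rw [norm_sq_eq_parts, norm_sq_eq_parts q]
  simp only [elemMul, cpart_quat, jpart_quat, one_mul, norm_mul, Complex.norm_real,
    Real.norm_of_nonneg hτ0]
  gcongr
  exact mul_le_of_le_one_left (norm_nonneg _) hτ1

lemma elemMul_sub (t p q : ℍ[ℝ]) : elemMul t (p - q) = elemMul t p - elemMul t q := by
  rw [elemMul, elemMul, elemMul, cpart_sub, jpart_sub, mul_sub, mul_sub]; rfl

end Quaternions

/-! ### Averages of diagonal blocks -/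

section BlockAverage

variable {N : ℕ}

/-- The average of the diagonal `2 × 2` blocks. -/
noncomputable def blockAvg (B : Matrix (Fin N × Fin 2) (Fin N × Fin 2) ℂ) :
    Matrix (Fin 2) (Fin 2) ℂ :=
  (N : ℂ)⁻¹ • ∑ i : Fin N, Matrix.of fun s t => B (i, s) (i, t)

lemma greenMat_eq_blockAvg (q : ℍ[ℝ]) (X : Matrix (Fin N) (Fin N) ℂ) :
    greenMat q X = blockAvg (resolvent q X) := rfl

lemma blockAvg_apply (B : Matrix (Fin N × Fin 2) (Fin N × Fin 2) ℂ) (a b : Fin 2) :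
    blockAvg B a b = (N : ℂ)⁻¹ * ∑ i : Fin N, B (i, a) (i, b) := by
  simp [blockAvg, Matrix.sum_apply]

lemma blockAvg_sub (B C : Matrix (Fin N × Fin 2) (Fin N × Fin 2) ℂ) :
    blockAvg (B - C) = blockAvg B - blockAvg C := by
  ext a b
  simp [blockAvg_apply, mul_sub]

lemma norm_blockAvg_le (B : Matrix (Fin N × Fin 2) (Fin N × Fin 2) ℂ) : ‖blockAvg B‖ ≤ ‖B‖ := by
  rw [blockAvg, norm_smul]
  have h : ‖∑ i : Fin N, Matrix.of fun s t => B (i, s) (i, t)‖ ≤ N * ‖B‖ := by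
    refine (norm_sum_le_of_le _ fun i _ => ?_).trans
      (le_of_eq (by rw [Finset.sum_const, Finset.card_univ, Fintype.card_fin, nsmul_eq_mul]))
    exact norm_submatrix_le B (f := fun s => (i, s)) (g := fun s => (i, s))
      (Prod.mk_right_injective i) (Prod.mk_right_injective i)
  rw [norm_inv, Complex.norm_natCast]
  rcases Nat.eq_zero_or_pos N with rfl | hN
  · simp
  · rw [inv_mul_le_iff₀ (by exact_mod_cast hN)]; exact h

/-- As normalised traces, entries of the average become accessible to cyclic permutation of factors.
-/
lemma blockAvg_eq_trace (B : Matrix (Fin N × Fin 2) (Fin N × Fin 2) ℂ) (a b : Fin 2) :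
    blockAvg B a b =
      (N : ℂ)⁻¹ * (B * ((1 : Matrix (Fin N) (Fin N) ℂ) ⊗ₖ Matrix.single b a 1)).trace := by
  rw [blockAvg_apply]
  simp [Matrix.trace, Matrix.mul_apply, Fintype.sum_prod_type, Matrix.one_apply, Matrix.single]
  left
  fin_cases a <;> fin_cases b <;> simp

lemma norm_one_kronecker_single_le (a b : Fin 2) :
    ‖(1 : Matrix (Fin N) (Fin N) ℂ) ⊗ₖ (Matrix.single a b 1 : Matrix (Fin 2) (Fin 2) ℂ)‖ ≤ 1 := by
  set K := (1 : Matrix (Fin N) (Fin N) ℂ) ⊗ₖ (Matrix.single a b 1 : Matrix (Fin 2) (Fin 2) ℂ)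
  have h2 := l2_opNorm_conjTranspose_mul_self K
  have h : Kᴴ * K = Matrix.diagonal fun x => if x.2 = b then 1 else 0 := by
    ext ⟨i, c⟩ ⟨j, d⟩
    by_cases hij : i = j
    · subst hij
      fin_cases a <;> fin_cases b <;> fin_cases c <;> fin_cases d <;>
      simp [K, Matrix.mul_apply, Fintype.sum_prod_type, Matrix.one_apply, Matrix.single]
    · simp [K, Matrix.mul_apply, Fintype.sum_prod_type, Matrix.one_apply, hij, Ne.symm hij]
  rw [h, l2_opNorm_diagonal] at h2
  have h3 : ‖(fun x : Fin N × Fin 2 => if x.2 = b then (1 : ℂ) else 0)‖ ≤ 1 := by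
    refine (pi_norm_le_iff_of_nonneg zero_le_one).2 fun x => ?_
    split_ifs <;> simp
  nlinarith [norm_nonneg K]

end BlockAverage

end QuatGreen

namespace QuatGreen

open Matrix
open scoped Matrix.Norms.L2Operator

/-! ### Invertibility, norm bound and symmetry of the resolvent -/

section Resolvent

variable {N : ℕ}

/-- The matrix which exchanges the two coordinates of every block. -/
def blockSwap (N : ℕ) : Matrix (Fin N × Fin 2) (Fin N × Fin 2) ℂ :=
  (1 : Matrix (Fin N) (Fin N) ℂ) ⊗ₖ !![0, 1; 1, 0]

lemma blockSwap_mul_self : blockSwap N * blockSwap N = 1 := by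
  rw [blockSwap, ← Matrix.mul_kronecker_mul, one_mul, ← Matrix.one_kronecker_one]
  congr 1
  ext a b
  fin_cases a <;> fin_cases b <;> simp [Matrix.mul_apply]

lemma blockSwap_conjTranspose : (blockSwap N)ᴴ = blockSwap N := by
  rw [blockSwap, Matrix.conjTranspose_kronecker, Matrix.conjTranspose_one]
  congr 1
  ext a b
  fin_cases a <;> fin_cases b <;> simp

lemma blockSwap_mul_apply (B : Matrix (Fin N × Fin 2) (Fin N × Fin 2) ℂ) (i : Fin N) (a : Fin 2)
    (y : Fin N × Fin 2) : (blockSwap N * B) (i, a) y = B (i, 1 - a) y := by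
  fin_cases a <;>
    simp [blockSwap, Matrix.mul_apply, Fintype.sum_prod_type, Matrix.one_apply]

lemma mul_blockSwap_apply (B : Matrix (Fin N × Fin 2) (Fin N × Fin 2) ℂ) (i : Fin N) (a : Fin 2)
    (x : Fin N × Fin 2) : (B * blockSwap N) x (i, a) = B x (i, 1 - a) := by
  fin_cases a <;>
    simp [blockSwap, Matrix.mul_apply, Fintype.sum_prod_type, Matrix.one_apply]

/-- This intertwining is what cancels the cross terms in `Mᴴ M` for the shifted matrix `M`. -/
lemma blockSwap_mul_bold (X : Matrix (Fin N) (Fin N) ℂ) :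
    blockSwap N * bold X = (bold X)ᴴ * blockSwap N := by
  ext ⟨i, a⟩ ⟨j, b⟩
  rw [blockSwap_mul_apply, mul_blockSwap_apply]
  fin_cases a <;> fin_cases b <;> simp [bold]

lemma bold_sub (X Y : Matrix (Fin N) (Fin N) ℂ) : bold (X - Y) = bold X - bold Y := by
  ext ⟨i, a⟩ ⟨j, b⟩
  fin_cases a <;> fin_cases b <;> simp [bold]

lemma shifted_quat (z : ℂ) (s : ℝ) (X : Matrix (Fin N) (Fin N) ℂ) :
    shifted (quat z s) X = bold (X - z • 1) - (Complex.I * s) • blockSwap N := by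
  ext ⟨i, a⟩ ⟨j, b⟩
  by_cases hij : i = j
  · subst hij
    fin_cases a <;> fin_cases b <;> simp [shifted, bold, toMat, blockSwap]
  · fin_cases a <;> fin_cases b <;> simp [shifted, bold, toMat, blockSwap, hij, Ne.symm hij]

lemma shifted_conjTranspose_mul_self (z : ℂ) (s : ℝ) (X : Matrix (Fin N) (Fin N) ℂ) :
    (shifted (quat z s) X)ᴴ * shifted (quat z s) X =
      (bold (X - z • 1))ᴴ * bold (X - z • 1) + ((s ^ 2 : ℝ) : ℂ) • 1 := by
  have h : star (Complex.I * s) = -(Complex.I * s) := by simp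
  have h2 : Complex.I * s * (Complex.I * s) = -((s ^ 2 : ℝ) : ℂ) := by
    rw [mul_mul_mul_comm, Complex.I_mul_I]; push_cast; ring
  rw [shifted_quat, Matrix.conjTranspose_sub, Matrix.conjTranspose_smul, blockSwap_conjTranspose, h,
    sub_mul, mul_sub, mul_sub]
  simp only [neg_smul, neg_mul, Matrix.smul_mul, Matrix.mul_smul, blockSwap_mul_bold,
    blockSwap_mul_self, smul_smul, h2]
  abel

open scoped ComplexOrder in
-- `Mᴴ M` is a positive semidefinite matrix plus `s²`, hence positive definite.
lemma isUnit_det_shifted (z : ℂ) {s : ℝ} (hs : 0 < s) (X : Matrix (Fin N) (Fin N) ℂ) :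
    IsUnit (shifted (quat z s) X).det := by
  have h : ((shifted (quat z s) X)ᴴ * shifted (quat z s) X).PosDef := by
    rw [shifted_conjTranspose_mul_self]
    refine Matrix.PosDef.posSemidef_add (Matrix.posSemidef_conjTranspose_mul_self _) ?_
    refine Matrix.PosDef.one.smul ?_
    exact_mod_cast (by positivity : (0 : ℝ) < s ^ 2)
  have h2 := (Matrix.isUnit_iff_isUnit_det _).1 h.isUnit
  rw [Matrix.det_mul] at h2
  exact isUnit_of_mul_isUnit_right h2

lemma shifted_mul_resolvent (z : ℂ) {s : ℝ} (hs : 0 < s) (X : Matrix (Fin N) (Fin N) ℂ) :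
    shifted (quat z s) X * resolvent (quat z s) X = 1 :=
  Matrix.mul_nonsing_inv _ (isUnit_det_shifted z hs X)

lemma resolvent_mul_shifted (z : ℂ) {s : ℝ} (hs : 0 < s) (X : Matrix (Fin N) (Fin N) ℂ) :
    resolvent (quat z s) X * shifted (quat z s) X = 1 :=
  Matrix.nonsing_inv_mul _ (isUnit_det_shifted z hs X)

open scoped MatrixOrder ComplexOrder in
-- Conjugating `Mᴴ M = Bᴴ B + s²` by `R` gives `1 = (B R)ᴴ (B R) + s² Rᴴ R`, so `s² Rᴴ R ≤ 1`.
lemma norm_resolvent_le (z : ℂ) {s : ℝ} (hs : 0 < s) (X : Matrix (Fin N) (Fin N) ℂ) :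
    ‖resolvent (quat z s) X‖ ≤ 1 / s := by
  set M := shifted (quat z s) X with hM
  set R := resolvent (quat z s) X with hR
  set B := bold (X - z • 1)
  have h1 : M * R = 1 := shifted_mul_resolvent z hs X
  have h2 : (1 : Matrix (Fin N × Fin 2) (Fin N × Fin 2) ℂ) =
      (B * R)ᴴ * (B * R) + ((s ^ 2 : ℝ) : ℂ) • (Rᴴ * R) := by
    calc (1 : Matrix (Fin N × Fin 2) (Fin N × Fin 2) ℂ) = (M * R)ᴴ * (M * R) := by rw [h1]; simp
      _ = Rᴴ * (Mᴴ * M) * R := by simp only [Matrix.conjTranspose_mul, Matrix.mul_assoc]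
      _ = _ := by
        rw [hM, shifted_conjTranspose_mul_self, mul_add, add_mul, Matrix.conjTranspose_mul]
        simp only [Matrix.mul_assoc, Matrix.mul_smul, Matrix.smul_mul, mul_one]
        rfl
  have h3 : ((s ^ 2 : ℝ) : ℂ) • (Rᴴ * R) ≤ 1 := by
    rw [Matrix.le_iff]
    have : (1 : Matrix (Fin N × Fin 2) (Fin N × Fin 2) ℂ) - ((s ^ 2 : ℝ) : ℂ) • (Rᴴ * R) =
      (B * R)ᴴ * (B * R) := sub_eq_of_eq_add h2
    rw [this]
    exact Matrix.posSemidef_conjTranspose_mul_self _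
  have h4 : 0 ≤ ((s ^ 2 : ℝ) : ℂ) • (Rᴴ * R) := by
    rw [Matrix.nonneg_iff_posSemidef]
    refine (Matrix.posSemidef_conjTranspose_mul_self R).smul ?_
    exact_mod_cast (by positivity : (0 : ℝ) ≤ s ^ 2)
  have h5 := CStarAlgebra.norm_le_norm_of_nonneg_of_le h4 h3
  have h6 : ‖(1 : Matrix (Fin N × Fin 2) (Fin N × Fin 2) ℂ)‖ ≤ 1 := by
    rw [← Matrix.diagonal_one, l2_opNorm_diagonal]
    exact (pi_norm_le_iff_of_nonneg zero_le_one).2 fun _ => by simp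
  rw [norm_smul, l2_opNorm_conjTranspose_mul_self, Complex.norm_real,
    Real.norm_of_nonneg (by positivity)] at h5
  rw [le_div_iff₀ hs]
  have : (‖R‖ * s) ^ 2 ≤ 1 ^ 2 := by linarith [show s ^ 2 * (‖R‖ * ‖R‖) = (‖R‖ * s) ^ 2 by ring]
  exact (pow_le_pow_iff_left₀ (by positivity) zero_le_one two_ne_zero).1 this

lemma resolvent_sub_resolvent {z z' : ℂ} {s s' : ℝ} (hs : 0 < s) (hs' : 0 < s')
    (X X' : Matrix (Fin N) (Fin N) ℂ) :
    resolvent (quat z s) X - resolvent (quat z' s') X' =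
      resolvent (quat z s) X * (bold (X' - X) +
        (1 : Matrix (Fin N) (Fin N) ℂ) ⊗ₖ toMat (quat z s - quat z' s')) *
        resolvent (quat z' s') X' := by
  have h : bold (X' - X) + (1 : Matrix (Fin N) (Fin N) ℂ) ⊗ₖ toMat (quat z s - quat z' s') =
      shifted (quat z' s') X' - shifted (quat z s) X := by
    rw [bold_sub, toMat_sub, shifted, shifted]
    ext ⟨i, a⟩ ⟨j, b⟩
    simp only [Matrix.add_apply, Matrix.sub_apply, Matrix.kroneckerMap_apply, mul_sub]
    ring
  rw [h, mul_sub, sub_mul, resolvent_mul_shifted z hs, one_mul, mul_assoc,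
    shifted_mul_resolvent z' hs', mul_one]

lemma resolvent_sub_resolvent_same {z : ℂ} {s : ℝ} (hs : 0 < s)
    (X X' : Matrix (Fin N) (Fin N) ℂ) :
    resolvent (quat z s) X - resolvent (quat z s) X' =
      resolvent (quat z s) X * bold (X' - X) * resolvent (quat z s) X' := by
  have h0 : toMat 0 = 0 := by
    ext a b; fin_cases a <;> fin_cases b <;> simp [toMat, cpart, jpart, Complex.ext_iff]
  rw [resolvent_sub_resolvent hs hs, sub_self, h0, Matrix.kronecker_zero, add_zero]

lemma norm_green_le (z : ℂ) {s : ℝ} (hs : 0 < s) (X : Matrix (Fin N) (Fin N) ℂ) :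
    ‖green (quat z s) X‖ ≤ 1 / s := by
  rw [← norm_toMat, toMat_green ⟨z, s, hs, rfl⟩, greenMat_eq_blockAvg]
  exact (norm_blockAvg_le _).trans (norm_resolvent_le z hs X)

lemma norm_green_sub_green_le {z z' : ℂ} {s s' : ℝ} (hs : 0 < s) (hs' : 0 < s')
    (X : Matrix (Fin N) (Fin N) ℂ) :
    ‖green (quat z s) X - green (quat z' s') X‖ ≤
      1 / s * ‖quat z s - quat z' s'‖ * (1 / s') := by
  have hb : bold (0 : Matrix (Fin N) (Fin N) ℂ) = 0 := by
    ext ⟨i, a⟩ ⟨j, b⟩; fin_cases a <;> fin_cases b <;> simp [bold]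
  rw [← norm_toMat, toMat_sub, toMat_green ⟨z, s, hs, rfl⟩, toMat_green ⟨z', s', hs', rfl⟩,
    greenMat_eq_blockAvg, greenMat_eq_blockAvg, ← blockAvg_sub, resolvent_sub_resolvent hs hs',
    sub_self, hb, zero_add]
  refine (norm_blockAvg_le _).trans ((norm_mul_le _ _).trans ?_)
  refine mul_le_mul ((norm_mul_le _ _).trans ?_) (norm_resolvent_le _ hs' _) (norm_nonneg _)
    (by positivity)
  exact mul_le_mul (norm_resolvent_le _ hs _) (norm_one_kronecker_toMat_le _ _) (norm_nonneg _)
    (by positivity)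

/-- Two symmetries of `M` are used. With the swap `J`, `J R - Rᴴ J = 2 i s Rᴴ R`, whose diagonal
gives the sign; with the skew matrix `W`, `W Rᴴ = R W` makes the relevant entries purely imaginary.
-/
lemma exists_jpart_green (z : ℂ) {s : ℝ} (hs : 0 < s) (X : Matrix (Fin N) (Fin N) ℂ) :
    ∃ b : ℝ, 0 ≤ b ∧ jpart (green (quat z s) X) = b := by
  set M := shifted (quat z s) X with hM
  set R := resolvent (quat z s) X with hR
  set J := blockSwap N with hJ
  have hMR : M * R = 1 := shifted_mul_resolvent z hs X
  have hRM : R * M = 1 := resolvent_mul_shifted z hs X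
  have hMRH : Rᴴ * Mᴴ = 1 := by rw [← Matrix.conjTranspose_mul, hMR, Matrix.conjTranspose_one]
  have hRMH : Mᴴ * Rᴴ = 1 := by rw [← Matrix.conjTranspose_mul, hRM, Matrix.conjTranspose_one]
  have hstar : star (Complex.I * s) = -(Complex.I * s) := by simp
  -- the imaginary part of the entry (i, 0), (i, 1)
  have h1 : Mᴴ * J - J * M = (2 * (Complex.I * s)) • 1 := by
    rw [hM, shifted_quat, Matrix.conjTranspose_sub, Matrix.conjTranspose_smul,
      blockSwap_conjTranspose, hstar, sub_mul, mul_sub, blockSwap_mul_bold, Matrix.smul_mul,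
      Matrix.mul_smul, blockSwap_mul_self, two_mul, add_smul, neg_smul]
    abel
  have h2 : J * R - Rᴴ * J = (2 * (Complex.I * s)) • (Rᴴ * R) := by
    calc J * R - Rᴴ * J = (Rᴴ * Mᴴ) * J * R - Rᴴ * J * (M * R) := by rw [hMRH, hMR]; simp
      _ = Rᴴ * (Mᴴ * J - J * M) * R := by
        rw [mul_sub, sub_mul]; simp only [Matrix.mul_assoc]
      _ = _ := by rw [h1]; simp
  have him : ∀ i, 0 ≤ (R (i, 0) (i, 1)).im := by
    intro i
    have e := congrFun (congrFun h2 (i, 1)) (i, 1)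
    rw [Matrix.sub_apply, hJ, blockSwap_mul_apply, mul_blockSwap_apply, Matrix.smul_apply,
      Matrix.mul_apply, smul_eq_mul] at e
    have e2 : ∀ x, star (R x (i, 1)) * R x (i, 1) = ((‖R x (i, 1)‖ ^ 2 : ℝ) : ℂ) := by
      intro x
      rw [Complex.star_def, Complex.conj_mul']
      push_cast; ring
    simp only [Matrix.conjTranspose_apply, e2, ← Complex.ofReal_sum, sub_self] at e
    have hr : 0 ≤ ∑ x, ‖R x (i, 1)‖ ^ 2 := by positivity
    generalize ∑ x, ‖R x (i, 1)‖ ^ 2 = r at e hr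
    have e3 := congrArg Complex.im e
    simp at e3
    nlinarith [mul_nonneg hs.le hr]
  -- the real part vanishes
  set W : Matrix (Fin N × Fin 2) (Fin N × Fin 2) ℂ :=
    (1 : Matrix (Fin N) (Fin N) ℂ) ⊗ₖ !![0, 1; -1, 0] with hW
  have hMW : M * W = W * Mᴴ := by
    ext ⟨i, a⟩ ⟨j, b⟩
    by_cases hij : i = j
    · subst hij
      fin_cases a <;> fin_cases b <;>
        simp [hM, hW, shifted, bold, toMat, Matrix.mul_apply,
          Fintype.sum_prod_type, Matrix.one_apply]
    · fin_cases a <;> fin_cases b <;>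
        simp [hM, hW, shifted, bold, toMat, Matrix.mul_apply,
          Fintype.sum_prod_type, Matrix.one_apply, hij, Ne.symm hij]
  have hRW : W * Rᴴ = R * W := by
    calc W * Rᴴ = (R * M) * W * Rᴴ := by rw [hRM, one_mul]
      _ = R * (M * W) * Rᴴ := by simp only [Matrix.mul_assoc]
      _ = R * W * (Mᴴ * Rᴴ) := by rw [hMW]; simp only [Matrix.mul_assoc]
      _ = R * W := by rw [hRMH, mul_one]
  have hre : ∀ i, (R (i, 0) (i, 1)).re = 0 := by
    intro i
    have e := congrFun (congrFun hRW (i, 0)) (i, 0)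
    simp [hW, Matrix.mul_apply, Fintype.sum_prod_type, Matrix.one_apply] at e
    have e2 := congrArg Complex.re e
    simp at e2
    linarith
  refine ⟨(N : ℝ)⁻¹ * ∑ i, (R (i, 0) (i, 1)).im, ?_, ?_⟩
  · exact mul_nonneg (by positivity) (Finset.sum_nonneg fun i _ => him i)
  · have e : ∀ i, R (i, 0) (i, 1) = Complex.I * ((R (i, 0) (i, 1)).im : ℂ) := fun i => by
      apply Complex.ext <;> simp [hre]
    rw [green, jpart_quat, greenMat_eq_blockAvg, blockAvg_apply, ← hR,
      Finset.sum_congr rfl fun i _ => e i, ← Finset.mul_sum]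
    push_cast
    linear_combination (-(N : ℂ)⁻¹ * ∑ i, ((R (i, 0) (i, 1)).im : ℂ)) * Complex.I_mul_I

end Resolvent

end QuatGreen

namespace QuatGreen

/-! ### The self-consistent equation as a contraction -/

section FixedPoint

/-- The quaternions `a + b j` with `b` real and nonnegative: the range of Green's functions. -/
def closedHalfSpace : Set ℍ[ℝ] := {g | 0 ≤ g.imJ ∧ g.imK = 0}

/-- Closedness carries membership over to the limit `GD` and supplies the completeness needed for
Banach's theorem. -/
lemma isClosed_closedHalfSpace : IsClosed closedHalfSpace :=
  (isClosed_le continuous_const Quaternion.continuous_imJ).inter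
    (isClosed_eq Quaternion.continuous_imK continuous_const)

lemma green_mem_closedHalfSpace {p : ℍ[ℝ]} (hp : p ∈ halfSpace) {N : ℕ}
    (X : Matrix (Fin N) (Fin N) ℂ) : green p X ∈ closedHalfSpace := by
  obtain ⟨z, s, hs, rfl⟩ := hp
  obtain ⟨b, hb, h⟩ := exists_jpart_green z hs X
  have h1 : (green (quat z s) X).imJ = b := congrArg Complex.re h
  have h2 : (green (quat z s) X).imK = 0 := congrArg Complex.im h
  exact ⟨h1 ▸ hb, h2⟩

/-- The point `z + ε j + t · g`, where `t = τ + j`, at which the self-consistent equation evaluates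
the limiting Green's function. -/
noncomputable def shiftPoint (z : ℂ) (ε τ : ℝ) (g : ℍ[ℝ]) : ℍ[ℝ] :=
  quat z ε + elemMul (quat τ 1) g

lemma shiftPoint_eq (z : ℂ) (ε τ : ℝ) {g : ℍ[ℝ]} (hg : g ∈ closedHalfSpace) :
    shiftPoint z ε τ g = quat (z + τ * cpart g) ((ε + g.imJ : ℝ) : ℂ) := by
  have h : jpart g = (g.imJ : ℂ) := Complex.ext rfl hg.2
  have h2 : quat z ε + quat (τ * cpart g) (jpart g) = quat (z + τ * cpart g) (ε + jpart g) := by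
    ext <;> rfl
  rw [shiftPoint, elemMul, cpart_quat, jpart_quat, one_mul, h2, h]
  push_cast
  rfl

lemma shiftPoint_sub (z : ℂ) (ε τ : ℝ) (g g' : ℍ[ℝ]) :
    shiftPoint z ε τ g - shiftPoint z ε τ g' = elemMul (quat τ 1) (g - g') := by
  rw [shiftPoint, shiftPoint, elemMul_sub]; abel

lemma shiftPoint_mem_halfSpace (z : ℂ) {ε : ℝ} (hε : 0 < ε) (τ : ℝ) {g : ℍ[ℝ]}
    (hg : g ∈ closedHalfSpace) : shiftPoint z ε τ g ∈ halfSpace :=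
  ⟨_, _, by linarith [hg.1], shiftPoint_eq z ε τ hg⟩

variable {D : (N : ℕ) → Matrix (Fin N) (Fin N) ℂ} {GD : ℍ[ℝ] → ℍ[ℝ]}

lemma limit_mem_closedHalfSpace
    (hD : ∀ p ∈ halfSpace, Tendsto (fun N => green p (D N)) atTop (𝓝 (GD p)))
    {p : ℍ[ℝ]} (hp : p ∈ halfSpace) : GD p ∈ closedHalfSpace :=
  isClosed_closedHalfSpace.mem_of_tendsto (hD p hp)
    (Eventually.of_forall fun _ => green_mem_closedHalfSpace hp _)

lemma norm_limit_sub_limit_le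
    (hD : ∀ p ∈ halfSpace, Tendsto (fun N => green p (D N)) atTop (𝓝 (GD p)))
    {z z' : ℂ} {s s' : ℝ} (hs : 0 < s) (hs' : 0 < s') :
    ‖GD (quat z s) - GD (quat z' s')‖ ≤ 1 / s * ‖quat z s - quat z' s'‖ * (1 / s') :=
  le_of_tendsto ((hD _ ⟨z, s, hs, rfl⟩).sub (hD _ ⟨z', s', hs', rfl⟩)).norm
    (Eventually.of_forall fun _ => norm_green_sub_green_le hs hs' _)

/-- Both evaluation points have j-part at least `ε`, because that of `g` and `g'` is nonnegative,
and multiplication by `t` does not increase the norm. -/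
lemma norm_limit_shiftPoint_sub_le
    (hD : ∀ p ∈ halfSpace, Tendsto (fun N => green p (D N)) atTop (𝓝 (GD p)))
    (z : ℂ) {ε τ : ℝ} (hε : 0 < ε) (hτ0 : 0 ≤ τ) (hτ1 : τ ≤ 1) {g g' : ℍ[ℝ]}
    (hg : g ∈ closedHalfSpace) (hg' : g' ∈ closedHalfSpace) :
    ‖GD (shiftPoint z ε τ g) - GD (shiftPoint z ε τ g')‖ ≤ (1 / ε ^ 2) * ‖g - g'‖ := by
  have h1 := norm_limit_sub_limit_le hD (z := z + τ * cpart g) (z' := z + τ * cpart g')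
    (s := ε + g.imJ) (s' := ε + g'.imJ) (by linarith [hg.1]) (by linarith [hg'.1])
  rw [← shiftPoint_eq z ε τ hg, ← shiftPoint_eq z ε τ hg', shiftPoint_sub] at h1
  refine h1.trans ?_
  have h2 : 1 / (ε + g.imJ) ≤ 1 / ε := one_div_le_one_div_of_le hε (by linarith [hg.1])
  have h3 : 1 / (ε + g'.imJ) ≤ 1 / ε := one_div_le_one_div_of_le hε (by linarith [hg'.1])
  have h4 := norm_elemMul_le hτ0 hτ1 (g - g')
  calc 1 / (ε + g.imJ) * ‖elemMul (quat τ 1) (g - g')‖ * (1 / (ε + g'.imJ))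
      ≤ 1 / ε * ‖g - g'‖ * (1 / ε) := by
        have := hg'.1
        gcongr
    _ = _ := by field_simp

/-- The self-consistent equation has exactly one solution. -/
lemma exists_unique_selfConsistent
    (hD : ∀ p ∈ halfSpace, Tendsto (fun N => green p (D N)) atTop (𝓝 (GD p)))
    (z : ℂ) {ε τ : ℝ} (hε : 1 < ε) (hτ0 : 0 ≤ τ) (hτ1 : τ ≤ 1) :
    ∃ g ∈ closedHalfSpace, g = GD (shiftPoint z ε τ g) ∧
      ∀ g', shiftPoint z ε τ g' ∈ halfSpace → g' = GD (shiftPoint z ε τ g') → g' = g := by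
  have hε0 : 0 < ε := by linarith
  have hK : 1 / ε ^ 2 < 1 := by
    rw [div_lt_one (by positivity)]; nlinarith
  have hmaps : Set.MapsTo (fun g => GD (shiftPoint z ε τ g)) closedHalfSpace closedHalfSpace :=
    fun g hg => limit_mem_closedHalfSpace hD (shiftPoint_mem_halfSpace z hε0 τ hg)
  have hcontr : ContractingWith ⟨1 / ε ^ 2, by positivity⟩
      (hmaps.restrict _ closedHalfSpace closedHalfSpace) := by
    refine ⟨hK, LipschitzWith.of_dist_le_mul fun g g' => ?_⟩
    rw [Subtype.dist_eq, Subtype.dist_eq, dist_eq_norm, dist_eq_norm]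
    exact norm_limit_shiftPoint_sub_le hD z hε0 hτ0 hτ1 g.2 g'.2
  have h0 : (0 : ℍ[ℝ]) ∈ closedHalfSpace := ⟨le_rfl, rfl⟩
  obtain ⟨g, hg, hfix, -⟩ := ContractingWith.exists_fixedPoint'
    isClosed_closedHalfSpace.isComplete hmaps hcontr h0 (edist_ne_top _ _)
  refine ⟨g, hg, hfix.symm, fun g' hg' hfix' => ?_⟩
  -- Any admissible solution is a value of `GD`, so it lies in the region where the contraction
  -- estimate holds.
  have hg's : g' ∈ closedHalfSpace := by
    rw [hfix']; exact limit_mem_closedHalfSpace hD hg'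
  have h := norm_limit_shiftPoint_sub_le hD z hε0 hτ0 hτ1 hg's hg
  rw [← hfix', show GD (shiftPoint z ε τ g) = g from hfix] at h
  by_contra hne
  have hpos : 0 < ‖g' - g‖ := norm_pos_iff.2 (sub_ne_zero.2 hne)
  nlinarith

end FixedPoint

end QuatGreen

namespace QuatGreen

open Matrix
open scoped Matrix.Norms.L2Operator

/-! ### The discrepancy and the stability estimate -/

section Discrepancy

variable {N : ℕ}

/-- The entries `τ, 1, 1, τ` by which the elementwise product with `τ + j` acts. -/
def coupling (τ : ℝ) : Matrix (Fin 2) (Fin 2) ℂ := !![(τ : ℂ), 1; 1, τ]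

lemma norm_coupling_le {τ : ℝ} (hτ0 : 0 ≤ τ) (hτ1 : τ ≤ 1) (c d : Fin 2) :
    ‖coupling τ c d‖ ≤ 1 := by
  have : |τ| ≤ 1 := by rwa [abs_of_nonneg hτ0]
  fin_cases c <;> fin_cases d <;> simp [coupling, this]

lemma toMat_elemMul_apply (τ : ℝ) (g : ℍ[ℝ]) (c d : Fin 2) :
    toMat (elemMul (quat τ 1) g) c d = coupling τ c d * toMat g c d := by
  fin_cases c <;> fin_cases d <;> simp [toMat, coupling, elemMul]

/-- The average of `R₀ (𝐀 + t · G) R`, where `R` and `G` are the resolvent and the Green's function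
of `D + A` at `z + ε j` and `R₀` is the resolvent of `D` at `z + ε j + t · g`. -/
noncomputable def discrepancy (D : Matrix (Fin N) (Fin N) ℂ) (z : ℂ) (ε τ : ℝ) (g : ℍ[ℝ])
    (A : Matrix (Fin N) (Fin N) ℂ) : Matrix (Fin 2) (Fin 2) ℂ :=
  blockAvg (resolvent (shiftPoint z ε τ g) D *
    (bold A + (1 : Matrix (Fin N) (Fin N) ℂ) ⊗ₖ
      toMat (elemMul (quat τ 1) (green (quat z ε) (D + A)))) *
    resolvent (quat z ε) (D + A))

variable (D : Matrix (Fin N) (Fin N) ℂ) (z : ℂ) {ε τ : ℝ} {g : ℍ[ℝ]}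

lemma norm_resolvent_shiftPoint_le (hε : 0 < ε) (hg : g ∈ closedHalfSpace) :
    ‖resolvent (shiftPoint z ε τ g) D‖ ≤ 1 / ε := by
  rw [shiftPoint_eq z ε τ hg]
  refine (norm_resolvent_le _ (by linarith [hg.1]) D).trans ?_
  exact one_div_le_one_div_of_le hε (by linarith [hg.1])

/-- Resolvent identity with `t · g = t · G + t · (g - G)`. On the right the unbounded matrix `A`
enters only through resolvents and Green's functions, so bounds uniform in `A` can be read off. -/
lemma discrepancy_eq (hε : 0 < ε) (hg : g ∈ closedHalfSpace) (A : Matrix (Fin N) (Fin N) ℂ) :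
    discrepancy D z ε τ g A =
      toMat (green (shiftPoint z ε τ g) D) - toMat (green (quat z ε) (D + A)) -
        blockAvg (resolvent (shiftPoint z ε τ g) D * ((1 : Matrix (Fin N) (Fin N) ℂ) ⊗ₖ
          toMat (elemMul (quat τ 1) (g - green (quat z ε) (D + A)))) *
            resolvent (quat z ε) (D + A)) := by
  have h := resolvent_sub_resolvent (z := z + τ * cpart g) (z' := z) (s := ε + g.imJ) (s' := ε)
    (by linarith [hg.1]) hε D (D + A)
  rw [← shiftPoint_eq z ε τ hg] at h
  have hsub : shiftPoint z ε τ g - quat z ε = elemMul (quat τ 1) g := by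
    rw [shiftPoint]; abel
  rw [toMat_green (shiftPoint_mem_halfSpace z hε τ hg), toMat_green ⟨z, ε, hε, rfl⟩,
    greenMat_eq_blockAvg, greenMat_eq_blockAvg, ← blockAvg_sub, ← blockAvg_sub, h, discrepancy,
    hsub, add_sub_cancel_left, elemMul_sub, toMat_sub]
  congr 1
  rw [← sub_mul, ← mul_sub]
  congr 2
  ext ⟨i, a⟩ ⟨j, b⟩
  simp only [Matrix.add_apply, Matrix.sub_apply, Matrix.kroneckerMap_apply, mul_sub]
  ring

lemma norm_blockAvg_kronecker_le (hε : 0 < ε) (hg : g ∈ closedHalfSpace) (hτ0 : 0 ≤ τ)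
    (hτ1 : τ ≤ 1) (A : Matrix (Fin N) (Fin N) ℂ) (k : ℍ[ℝ]) :
    ‖resolvent (shiftPoint z ε τ g) D * ((1 : Matrix (Fin N) (Fin N) ℂ) ⊗ₖ
      toMat (elemMul (quat τ 1) k)) * resolvent (quat z ε) (D + A)‖ ≤ 1 / ε ^ 2 * ‖k‖ := by
  have h1 := norm_resolvent_shiftPoint_le (τ := τ) D z hε hg
  have h2 := norm_resolvent_le z hε (D + A)
  have h3 := (norm_one_kronecker_toMat_le N _).trans (norm_elemMul_le hτ0 hτ1 k)
  calc _ ≤ 1 / ε * ‖k‖ * (1 / ε) :=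
        (norm_mul_le _ _).trans (mul_le_mul ((norm_mul_le _ _).trans (mul_le_mul h1 h3
          (norm_nonneg _) (by positivity))) h2 (norm_nonneg _) (by positivity))
    _ = _ := by field_simp

/-- The Green's function of the perturbed matrix is close to `g` when the discrepancy is small. -/
lemma norm_green_sub_le (hε : 0 < ε) (hg : g ∈ closedHalfSpace) (hτ0 : 0 ≤ τ)
    (hτ1 : τ ≤ 1) (A : Matrix (Fin N) (Fin N) ℂ) :
    (1 - 1 / ε ^ 2) * ‖green (quat z ε) (D + A) - g‖ ≤
      ‖green (shiftPoint z ε τ g) D - g‖ + ‖discrepancy D z ε τ g A‖ := by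
  have h := discrepancy_eq (τ := τ) D z hε hg A
  set W := resolvent (shiftPoint z ε τ g) D * ((1 : Matrix (Fin N) (Fin N) ℂ) ⊗ₖ
      toMat (elemMul (quat τ 1) (g - green (quat z ε) (D + A)))) * resolvent (quat z ε) (D + A)
  have hW : ‖blockAvg W‖ ≤ 1 / ε ^ 2 * ‖g - green (quat z ε) (D + A)‖ :=
    (norm_blockAvg_le _).trans (norm_blockAvg_kronecker_le D z hε hg hτ0 hτ1 A _)
  have e : toMat (green (quat z ε) (D + A) - g) =
      toMat (green (shiftPoint z ε τ g) D - g) - discrepancy D z ε τ g A - blockAvg W := by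
    rw [h, toMat_sub, toMat_sub]; abel
  have h2 : ‖green (quat z ε) (D + A) - g‖ ≤ ‖green (shiftPoint z ε τ g) D - g‖ +
      ‖discrepancy D z ε τ g A‖ + ‖blockAvg W‖ := by
    rw [← norm_toMat, e, ← norm_toMat (green (shiftPoint z ε τ g) D - g)]
    exact (norm_sub_le _ _).trans (add_le_add_left (norm_sub_le _ _) _)
  -- The term `‖blockAvg W‖` is absorbed into the left side, leaving the factor `1 - 1 / ε ^ 2`.
  rw [norm_sub_rev g] at hW
  linarith

lemma norm_discrepancy_le (hε : 1 ≤ ε) (hg : g ∈ closedHalfSpace) (hg1 : ‖g‖ ≤ 1) (hτ0 : 0 ≤ τ)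
    (hτ1 : τ ≤ 1) (A : Matrix (Fin N) (Fin N) ℂ) : ‖discrepancy D z ε τ g A‖ ≤ 4 := by
  have hε0 : 0 < ε := by linarith
  have hε1 : 1 / ε ≤ 1 := (div_le_one hε0).2 hε
  have hε2 : 1 / ε ^ 2 ≤ 1 := (div_le_one (by positivity)).2 (one_le_pow₀ hε)
  have h1 : ‖green (quat z ε) (D + A)‖ ≤ 1 := (norm_green_le z hε0 _).trans hε1
  have h2 : ‖green (shiftPoint z ε τ g) D‖ ≤ 1 := by
    rw [← norm_toMat, toMat_green (shiftPoint_mem_halfSpace z hε0 τ hg), greenMat_eq_blockAvg]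
    exact (norm_blockAvg_le _).trans ((norm_resolvent_shiftPoint_le D z hε0 hg).trans hε1)
  rw [discrepancy_eq D z hε0 hg]
  refine (norm_sub_le _ _).trans ?_
  have h3 := (norm_blockAvg_le _).trans (norm_blockAvg_kronecker_le D z hε0 hg hτ0 hτ1 A
    (g - green (quat z ε) (D + A)))
  have h4 := norm_sub_le g (green (quat z ε) (D + A))
  have h5 := norm_sub_le (toMat (green (shiftPoint z ε τ g) D)) (toMat (green (quat z ε) (D + A)))
  rw [norm_toMat, norm_toMat] at h5
  have h6 : 1 / ε ^ 2 * ‖g - green (quat z ε) (D + A)‖ ≤ 1 * 2 :=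
    mul_le_mul hε2 (by linarith) (norm_nonneg _) zero_le_one
  linarith

end Discrepancy

/-! ### Deleting a transposed pair of entries -/

section PairRemoval

variable {N : ℕ}

/-- The matrix `X` with its entries `(i, j)` and `(j, i)` replaced by zero. -/
def removePair (i j : Fin N) (X : Matrix (Fin N) (Fin N) ℂ) : Matrix (Fin N) (Fin N) ℂ :=
  Matrix.of fun k l => if (k = i ∧ l = j) ∨ (k = j ∧ l = i) then 0 else X k l

lemma norm_bold_le (X : Matrix (Fin N) (Fin N) ℂ) (i j : Fin N) (c : Fin 2) :
    ‖bold X (i, c) (j, c)‖ ≤ ‖X i j‖ + ‖X j i‖ := by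
  fin_cases c <;> simp [bold]

lemma bold_removePair {i j : Fin N} (hij : i ≠ j) (X : Matrix (Fin N) (Fin N) ℂ) :
    bold (X - removePair i j X) = ∑ d : Fin 2,
      (Matrix.single (i, d) (j, d) (bold X (i, d) (j, d)) +
        Matrix.single (j, d) (i, d) (bold X (j, d) (i, d))) := by
  ext ⟨k, a⟩ ⟨l, b⟩
  by_cases hki : k = i <;> by_cases hlj : l = j <;> by_cases hkj : k = j <;>
    by_cases hli : l = i <;> fin_cases a <;> fin_cases b <;>
    simp_all [bold, removePair, Matrix.single_apply, eq_comm]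

lemma mul_single_mul_apply {m : Type*} [Fintype m] [DecidableEq m] (P Q : Matrix m m ℂ)
    (x y : m) (c : ℂ) (v w : m) : (P * Matrix.single x y c * Q) v w = c * (P v x * Q y w) := by
  rw [Matrix.mul_assoc, Matrix.mul_apply, Finset.sum_eq_single x]
  · simp [Matrix.mul_apply, Matrix.single_apply]; ring
  · intro b _ hb
    simp [Matrix.mul_apply, Ne.symm hb]
  · simp

lemma mul_bold_removePair_mul_apply {i j : Fin N} (hij : i ≠ j) (X : Matrix (Fin N) (Fin N) ℂ)
    (P Q : Matrix (Fin N × Fin 2) (Fin N × Fin 2) ℂ) (v w : Fin N × Fin 2) :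
    (P * bold (X - removePair i j X) * Q) v w = ∑ d : Fin 2,
      (bold X (i, d) (j, d) * (P v (i, d) * Q (j, d) w) +
        bold X (j, d) (i, d) * (P v (j, d) * Q (i, d) w)) := by
  rw [bold_removePair hij, Matrix.mul_sum, Matrix.sum_mul, Matrix.sum_apply]
  refine Finset.sum_congr rfl fun d _ => ?_
  rw [mul_add, add_mul, Matrix.add_apply, mul_single_mul_apply, mul_single_mul_apply]

lemma norm_bold_removePair_le {i j : Fin N} (hij : i ≠ j) (X : Matrix (Fin N) (Fin N) ℂ) :
    ‖bold (X - removePair i j X)‖ ≤ 4 * (‖X i j‖ + ‖X j i‖) := by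
  rw [bold_removePair hij, Fin.sum_univ_two]
  have h (x y : Fin N × Fin 2) (c : ℂ) (hc : ‖c‖ ≤ ‖X i j‖ + ‖X j i‖) :
      ‖Matrix.single x y c‖ ≤ ‖X i j‖ + ‖X j i‖ := (norm_single_le x y c).trans hc
  have b1 (d : Fin 2) := h (i, d) (j, d) _ (norm_bold_le X i j d)
  have b2 (d : Fin 2) := h (j, d) (i, d) _ ((norm_bold_le X j i d).trans_eq (add_comm _ _))
  have := norm_add_le_of_le (norm_add_le_of_le (b1 0) (b2 0)) (norm_add_le_of_le (b1 1) (b2 1))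
  linarith

/-- The perturbation is a sum of four matrix units, so the trace picks out four entries of the
contraction `Q K P`. The factor `1 / N` of the average survives, which a bound on the operator norm
of the product would lose. -/
lemma norm_blockAvg_mul_bold_removePair_mul_le {i j : Fin N} (hij : i ≠ j)
    (X : Matrix (Fin N) (Fin N) ℂ) {P Q : Matrix (Fin N × Fin 2) (Fin N × Fin 2) ℂ}
    (hP : ‖P‖ ≤ 1) (hQ : ‖Q‖ ≤ 1) (a b : Fin 2) :
    ‖blockAvg (P * bold (X - removePair i j X) * Q) a b‖ ≤
      (N : ℝ)⁻¹ * (4 * (‖X i j‖ + ‖X j i‖)) := by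
  set K := (1 : Matrix (Fin N) (Fin N) ℂ) ⊗ₖ (Matrix.single b a 1 : Matrix (Fin 2) (Fin 2) ℂ)
  have hC : ‖Q * K * P‖ ≤ 1 := by
    have hK : ‖K‖ ≤ 1 := norm_one_kronecker_single_le b a
    calc ‖Q * K * P‖ ≤ 1 * 1 * 1 :=
          (norm_mul_le _ _).trans (mul_le_mul ((norm_mul_le _ _).trans (mul_le_mul hQ hK
            (norm_nonneg _) zero_le_one)) hP (norm_nonneg _) (by norm_num))
      _ = 1 := by norm_num
  rw [blockAvg_eq_trace, norm_mul, norm_inv, Complex.norm_natCast]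
  refine mul_le_mul_of_nonneg_left ?_ (by positivity)
  have e : (P * bold (X - removePair i j X) * Q * K).trace =
      ∑ d : Fin 2, (bold X (i, d) (j, d) * (Q * K * P) (j, d) (i, d) +
        bold X (j, d) (i, d) * (Q * K * P) (i, d) (j, d)) := by
    rw [Matrix.mul_assoc, Matrix.mul_assoc, Matrix.trace_mul_comm, Matrix.mul_assoc,
      bold_removePair hij, Matrix.sum_mul, Matrix.trace_sum]
    refine Finset.sum_congr rfl fun d _ => ?_
    rw [add_mul, Matrix.trace_add, Matrix.trace_single_mul, Matrix.trace_single_mul]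
    rfl
  have h (u : ℂ) (hu : ‖u‖ ≤ ‖X i j‖ + ‖X j i‖) (x y : Fin N × Fin 2) :
      ‖u * (Q * K * P) x y‖ ≤ ‖X i j‖ + ‖X j i‖ := by
    rw [norm_mul]
    exact (mul_le_of_le_one_right (norm_nonneg _) ((norm_entry_le _ _ _).trans hC)).trans hu
  have b1 (d : Fin 2) := h _ (norm_bold_le X i j d) (j, d) (i, d)
  have b2 (d : Fin 2) := h _ ((norm_bold_le X j i d).trans_eq (add_comm _ _)) (i, d) (j, d)
  rw [e, Fin.sum_univ_two]
  have := norm_add_le_of_le (norm_add_le_of_le (b1 0) (b2 0)) (norm_add_le_of_le (b1 1) (b2 1))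
  linarith

lemma norm_le_sum_entries (B : Matrix (Fin 2) (Fin 2) ℂ) :
    ‖B‖ ≤ ‖B 0 0‖ + ‖B 0 1‖ + ‖B 1 0‖ + ‖B 1 1‖ := by
  have := norm_le_sum_norm B
  simp only [Fin.sum_univ_two] at this
  linarith

variable (D : Matrix (Fin N) (Fin N) ℂ) (z : ℂ) {ε τ : ℝ} {g : ℍ[ℝ]}

/-- Removing a pair of entries changes the discrepancy by `O(1 / N)`. -/
lemma norm_discrepancy_sub_removePair_le (hε : 1 ≤ ε) (hg : g ∈ closedHalfSpace) (hg1 : ‖g‖ ≤ 1)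
    (hτ0 : 0 ≤ τ) (hτ1 : τ ≤ 1) {i j : Fin N} (hij : i ≠ j) (X : Matrix (Fin N) (Fin N) ℂ)
    (a b : Fin 2) :
    ‖discrepancy D z ε τ g X a b - discrepancy D z ε τ g (removePair i j X) a b‖ ≤
      44 * (N : ℝ)⁻¹ * (‖X i j‖ + ‖X j i‖) := by
  have hε0 : 0 < ε := by linarith
  have hε1 : 1 / ε ≤ 1 := (div_le_one hε0).2 hε
  have hε2 : 1 / ε ^ 2 ≤ 1 := (div_le_one (by positivity)).2 (one_le_pow₀ hε)
  set X' := removePair i j X with hX'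
  set R0 := resolvent (shiftPoint z ε τ g) D
  set R := resolvent (quat z ε) (D + X) with hRdef
  set R' := resolvent (quat z ε) (D + X') with hRdef'
  set G := green (quat z ε) (D + X) with hG
  set G' := green (quat z ε) (D + X') with hG'
  have hR0 : ‖R0‖ ≤ 1 := (norm_resolvent_shiftPoint_le D z hε0 hg).trans hε1
  have hR : ‖R‖ ≤ 1 := (norm_resolvent_le z hε0 _).trans hε1
  have hR' : ‖R'‖ ≤ 1 := (norm_resolvent_le z hε0 _).trans hε1
  have hG1 : ‖G‖ ≤ 1 := (norm_green_le z hε0 _).trans hε1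
  have hres : R' - R = R' * bold (X - X') * R := by
    rw [hRdef, hRdef', resolvent_sub_resolvent_same hε0]; congr 3; abel
  set η := (N : ℝ)⁻¹ * (4 * (‖X i j‖ + ‖X j i‖)) with hη
  have hGent : ∀ c d, ‖(toMat G - toMat G') c d‖ ≤ η := by
    intro c d
    rw [hG, hG', toMat_green ⟨z, ε, hε0, rfl⟩, toMat_green ⟨z, ε, hε0, rfl⟩, ← neg_sub,
      Matrix.neg_apply, norm_neg, greenMat_eq_blockAvg, greenMat_eq_blockAvg, ← blockAvg_sub]
    change ‖blockAvg (R' - R) c d‖ ≤ η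
    rw [hres]
    exact norm_blockAvg_mul_bold_removePair_mul_le hij X hR' hR c d
  have hGG : ‖G - G'‖ ≤ 4 * η := by
    rw [← norm_toMat, toMat_sub]
    refine (norm_le_sum_entries _).trans ?_
    linarith [hGent 0 0, hGent 0 1, hGent 1 0, hGent 1 1]
  set T : ℍ[ℝ] → Matrix (Fin N × Fin 2) (Fin N × Fin 2) ℂ := fun k =>
    (1 : Matrix (Fin N) (Fin N) ℂ) ⊗ₖ toMat (elemMul (quat τ 1) k) with hT
  -- Only the change of `R` needs the trace estimate; the change of `G` is already of order `1 / N`.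
  have e : R0 * T (g - G) * R - R0 * T (g - G') * R' =
      -(R0 * T (g - G) * R' * bold (X - X') * R) - R0 * T (G - G') * R' := by
    have h1 : T (g - G') = T (g - G) + T (G - G') := by
      simp only [hT]
      rw [← Matrix.kronecker_add, ← toMat_add]
      congr 2
      simp only [elemMul_sub]; abel
    have h2 : R0 * T (g - G) * R' * bold (X - X') * R = R0 * T (g - G) * (R' - R) := by
      rw [hres]; simp only [Matrix.mul_assoc]
    rw [h1, h2, mul_add, add_mul, mul_sub]; abel
  have b1 : ‖blockAvg (R0 * T (g - G) * R' * bold (X - X') * R) a b‖ ≤ 2 * η := by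
    have hTn : ‖R0 * T (g - G) * R'‖ ≤ 2 := by
      refine (norm_blockAvg_kronecker_le D z hε0 hg hτ0 hτ1 X' (g - G)).trans ?_
      have := norm_sub_le g G
      calc _ ≤ 1 * (2 : ℝ) := mul_le_mul hε2 (by linarith) (norm_nonneg _) zero_le_one
        _ = 2 := one_mul _
    -- The left factor has norm at most 2; it is halved to meet the normalisation of the trace
    -- estimate.
    have h1 : R0 * T (g - G) * R' * bold (X - X') * R =
        (2 : ℂ) • (((1 / 2 : ℂ) • (R0 * T (g - G) * R')) * bold (X - X') * R) := by
      rw [Matrix.smul_mul, Matrix.smul_mul, smul_smul]; norm_num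
    have h2 : ‖(1 / 2 : ℂ) • (R0 * T (g - G) * R')‖ ≤ 1 := by
      rw [norm_smul]; norm_num; linarith
    have h3 := norm_blockAvg_mul_bold_removePair_mul_le hij X h2 hR a b
    have h4 (B : Matrix (Fin N × Fin 2) (Fin N × Fin 2) ℂ) :
        blockAvg ((2 : ℂ) • B) a b = 2 * blockAvg B a b := by
      simp only [blockAvg_apply, Matrix.smul_apply, smul_eq_mul, ← Finset.mul_sum]; ring
    rw [h1, h4, norm_mul, Complex.norm_ofNat]
    linarith
  have b2 : ‖blockAvg (R0 * T (G - G') * R') a b‖ ≤ 4 * η := by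
    refine (norm_entry_le _ _ _).trans ((norm_blockAvg_le _).trans ?_)
    refine (norm_blockAvg_kronecker_le D z hε0 hg hτ0 hτ1 X' (G - G')).trans ?_
    exact (mul_le_of_le_one_left (norm_nonneg _) hε2).trans hGG
  have b3 := hGent a b
  have e2 : discrepancy D z ε τ g X a b - discrepancy D z ε τ g X' a b =
      -(toMat G - toMat G') a b + blockAvg (R0 * T (g - G) * R' * bold (X - X') * R) a b +
        blockAvg (R0 * T (G - G') * R') a b := by
    rw [discrepancy_eq D z hε0 hg, discrepancy_eq D z hε0 hg]
    have h1 := congrFun (congrFun (congrArg blockAvg e) a) b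
    have h0 (B : Matrix (Fin N × Fin 2) (Fin N × Fin 2) ℂ) :
        blockAvg (-B) a b = -blockAvg B a b := by
      simp [blockAvg_apply]
    rw [blockAvg_sub, blockAvg_sub, Matrix.sub_apply, Matrix.sub_apply, h0] at h1
    simp only [Matrix.sub_apply]
    linear_combination -h1
  rw [e2]
  have hη0 : 0 ≤ η := by positivity
  -- The three contributions total `7 η`, that is 28 in place of the stated 44.
  have := norm_add_le_of_le (norm_add_le_of_le ((norm_neg _).trans_le b3) b1) b2
  refine this.trans ?_
  rw [hη] at hη0 ⊢
  linarith

end PairRemoval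

end QuatGreen

namespace QuatGreen

open Matrix

/-! ### Continuity in the random matrix, needed for measurability -/

section Continuity

variable {N : ℕ}

lemma continuous_bold : Continuous fun X : Matrix (Fin N) (Fin N) ℂ => bold X := by
  refine continuous_matrix fun x y => ?_
  obtain ⟨i, a⟩ := x
  obtain ⟨j, b⟩ := y
  fin_cases a <;> fin_cases b <;> simp [bold] <;> fun_prop

/-- Cramer's rule, with a determinant that vanishes for no `X`. -/
lemma continuous_resolvent_add (D : Matrix (Fin N) (Fin N) ℂ) (z : ℂ) {s : ℝ} (hs : 0 < s) :
    Continuous fun X : Matrix (Fin N) (Fin N) ℂ => resolvent (quat z s) (D + X) := by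
  have h1 : Continuous fun X : Matrix (Fin N) (Fin N) ℂ => shifted (quat z s) (D + X) :=
    (continuous_bold.comp (continuous_const.add continuous_id)).sub continuous_const
  have h2 (X : Matrix (Fin N) (Fin N) ℂ) : resolvent (quat z s) (D + X) =
      ((shifted (quat z s) (D + X)).det)⁻¹ • (shifted (quat z s) (D + X)).adjugate := by
    rw [resolvent, Matrix.inv_def, Ring.inverse_eq_inv']
  simp only [h2]
  exact (h1.matrix_det.inv₀ fun X => (isUnit_det_shifted z hs (D + X)).ne_zero).smul
    h1.matrix_adjugate

lemma continuous_discrepancy (D : Matrix (Fin N) (Fin N) ℂ) (z : ℂ) {ε : ℝ} (hε : 0 < ε) (τ : ℝ)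
    (g : ℍ[ℝ]) (a b : Fin 2) :
    Continuous fun X : Matrix (Fin N) (Fin N) ℂ => discrepancy D z ε τ g X a b := by
  have hR := continuous_resolvent_add D z hε
  have hT : Continuous fun X : Matrix (Fin N) (Fin N) ℂ =>
      (1 : Matrix (Fin N) (Fin N) ℂ) ⊗ₖ toMat (elemMul (quat τ 1) (green (quat z ε) (D + X))) := by
    refine continuous_matrix fun x y => ?_
    simp only [Matrix.kroneckerMap_apply, toMat_elemMul_apply, toMat_green ⟨z, ε, hε, rfl⟩,
      greenMat_eq_blockAvg, blockAvg_apply]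
    refine continuous_const.mul (continuous_const.mul (continuous_const.mul ?_))
    exact continuous_finsetSum _ fun i _ => hR.matrix_elem _ _
  simp only [discrepancy, blockAvg_apply]
  refine continuous_const.mul (continuous_finsetSum _ fun i _ => ?_)
  exact (((continuous_const.matrix_mul (continuous_bold.add hT)).matrix_mul hR)).matrix_elem _ _

end Continuity

open scoped Matrix.Norms.L2Operator

/-! ### Second-order expansion in a pair of entries -/

section Expansion

variable {N : ℕ} (D : Matrix (Fin N) (Fin N) ℂ) (z : ℂ) {ε τ : ℝ} {g : ℍ[ℝ]}

/-- The product of the resolvent of `D + X`, the matrix unit `(b, a)` in every diagonal block, and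
the resolvent of `D`: the matrix whose trace against `𝐗 + t · G` is `N` times the discrepancy. -/
noncomputable def sideResolvent (ε τ : ℝ) (g : ℍ[ℝ]) (a b : Fin 2)
    (X : Matrix (Fin N) (Fin N) ℂ) : Matrix (Fin N × Fin 2) (Fin N × Fin 2) ℂ :=
  resolvent (quat z ε) (D + X) * (((1 : Matrix (Fin N) (Fin N) ℂ) ⊗ₖ Matrix.single b a 1) *
    resolvent (shiftPoint z ε τ g) D)

lemma norm_side_factor_le (hε : 1 ≤ ε) (hg : g ∈ closedHalfSpace) (a b : Fin 2) :
    ‖((1 : Matrix (Fin N) (Fin N) ℂ) ⊗ₖ (Matrix.single b a 1 : Matrix (Fin 2) (Fin 2) ℂ)) *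
      resolvent (shiftPoint z ε τ g) D‖ ≤ 1 := by
  have hε0 : 0 < ε := by linarith
  have hε1 : 1 / ε ≤ 1 := (div_le_one hε0).2 hε
  refine (norm_mul_le _ _).trans ?_
  exact mul_le_one₀ (norm_one_kronecker_single_le b a) (norm_nonneg _)
    ((norm_resolvent_shiftPoint_le D z hε0 hg).trans hε1)

lemma norm_resolvent_le_one (hε : 1 ≤ ε) (X : Matrix (Fin N) (Fin N) ℂ) :
    ‖resolvent (quat z ε) X‖ ≤ 1 :=
  (norm_resolvent_le z (by linarith) X).trans ((div_le_one (by linarith)).2 hε)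

lemma norm_sideResolvent_le (hε : 1 ≤ ε) (hg : g ∈ closedHalfSpace) (a b : Fin 2)
    (X : Matrix (Fin N) (Fin N) ℂ) : ‖sideResolvent D z ε τ g a b X‖ ≤ 1 :=
  (norm_mul_le _ _).trans (mul_le_one₀ (norm_resolvent_le_one z hε _) (norm_nonneg _)
    (norm_side_factor_le D z hε hg a b))

/-- Since `G` is itself an average over `j`, the term `t · G` can be distributed over all pairs `(i,
j)`. Each matrix entry then carries the counterterm that its covariance will cancel. -/
lemma natCast_mul_discrepancy (hε : 0 < ε) (hN : N ≠ 0) (a b : Fin 2)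
    (X : Matrix (Fin N) (Fin N) ℂ) :
    (N : ℂ) * discrepancy D z ε τ g X a b = ∑ i : Fin N, ∑ j : Fin N, ∑ c : Fin 2,
      (bold X (i, c) (j, c) * sideResolvent D z ε τ g a b X (j, c) (i, c) +
        (N : ℂ)⁻¹ * ∑ d : Fin 2, coupling τ c d *
          (resolvent (quat z ε) (D + X) (j, c) (j, d) *
            sideResolvent D z ε τ g a b X (i, d) (i, c))) := by
  have hN' : (N : ℂ) ≠ 0 := by exact_mod_cast hN
  set S := sideResolvent D z ε τ g a b X with hS
  set R := resolvent (quat z ε) (D + X) with hR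
  set T := toMat (elemMul (quat τ 1) (green (quat z ε) (D + X))) with hT
  have h1 : (N : ℂ) * discrepancy D z ε τ g X a b =
      (bold X * S).trace + (((1 : Matrix (Fin N) (Fin N) ℂ) ⊗ₖ T) * S).trace := by
    rw [discrepancy, blockAvg_eq_trace, mul_inv_cancel_left₀ hN', ← Matrix.trace_add, ← add_mul,
      Matrix.mul_assoc, Matrix.mul_assoc, Matrix.trace_mul_comm, hS, sideResolvent]
    simp only [Matrix.mul_assoc]
    rfl
  have h2 : (bold X * S).trace =
      ∑ i : Fin N, ∑ j : Fin N, ∑ c : Fin 2, bold X (i, c) (j, c) * S (j, c) (i, c) := by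
    simp only [Matrix.trace, Matrix.diag, Matrix.mul_apply, Fintype.sum_prod_type,
      Fin.sum_univ_two]
    refine Finset.sum_congr rfl fun i _ => ?_
    rw [← Finset.sum_add_distrib]
    refine Finset.sum_congr rfl fun j _ => ?_
    simp [bold]
  have h3 : (((1 : Matrix (Fin N) (Fin N) ℂ) ⊗ₖ T) * S).trace =
      ∑ i : Fin N, ∑ c : Fin 2, ∑ d : Fin 2, T c d * S (i, d) (i, c) := by
    simp only [Matrix.trace, Matrix.diag, Matrix.mul_apply, Fintype.sum_prod_type,
      Fin.sum_univ_two]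
    refine Finset.sum_congr rfl fun i _ => ?_
    simp [Matrix.one_apply, Finset.sum_add_distrib]
  have h4 (c d : Fin 2) : T c d = (N : ℂ)⁻¹ * ∑ j, coupling τ c d * R (j, c) (j, d) := by
    rw [hT, toMat_elemMul_apply, toMat_green ⟨z, ε, hε, rfl⟩, greenMat_eq_blockAvg, blockAvg_apply,
      ← Finset.mul_sum]
    ring
  rw [h1, h2, h3]
  simp only [Finset.sum_add_distrib]
  congr 1
  refine Finset.sum_congr rfl fun i _ => ?_
  conv_rhs => rw [Finset.sum_comm]
  refine Finset.sum_congr rfl fun c _ => ?_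
  conv_rhs => rw [← Finset.mul_sum, Finset.sum_comm, Finset.mul_sum]
  refine Finset.sum_congr rfl fun d _ => ?_
  rw [h4, mul_assoc, Finset.sum_mul]
  simp only [mul_assoc]

/-- Expansion of an entry to second order in a pair of matrix elements. -/
lemma norm_expansion_le (hε : 1 ≤ ε) (hg : g ∈ closedHalfSpace) (hg1 : ‖g‖ ≤ 1)
    (hτ0 : 0 ≤ τ) (hτ1 : τ ≤ 1) {i j : Fin N} (hij : i ≠ j) (X : Matrix (Fin N) (Fin N) ℂ)
    (a b c : Fin 2) :
    ‖bold X (i, c) (j, c) * sideResolvent D z ε τ g a b X (j, c) (i, c) *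
        star (discrepancy D z ε τ g X a b) -
      (bold X (i, c) (j, c) * (sideResolvent D z ε τ g a b (removePair i j X) (j, c) (i, c) *
        star (discrepancy D z ε τ g (removePair i j X) a b)) -
       ∑ d : Fin 2, (bold X (i, c) (j, c) * bold X (i, d) (j, d) *
          (resolvent (quat z ε) (D + removePair i j X) (j, c) (i, d) *
            sideResolvent D z ε τ g a b (removePair i j X) (j, d) (i, c) *
            star (discrepancy D z ε τ g (removePair i j X) a b)) +
         bold X (i, c) (j, c) * bold X (j, d) (i, d) *
          (resolvent (quat z ε) (D + removePair i j X) (j, c) (j, d) *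
            sideResolvent D z ε τ g a b (removePair i j X) (i, d) (i, c) *
            star (discrepancy D z ε τ g (removePair i j X) a b))))‖ ≤
      44 * (N : ℝ)⁻¹ * (‖X i j‖ + ‖X j i‖) ^ 2 + 64 * (‖X i j‖ + ‖X j i‖) ^ 3 := by
  have hε0 : 0 < ε := by linarith
  set X' := removePair i j X with hX'
  have hY' := (norm_entry_le _ a b).trans (norm_discrepancy_le D z hε hg hg1 hτ0 hτ1 X')
  have hYY := norm_discrepancy_sub_removePair_le D z hε hg hg1 hτ0 hτ1 hij X a b
  rw [← hX'] at hYY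
  have hA := norm_bold_removePair_le hij X
  rw [← hX'] at hA
  have hRe := norm_resolvent_le_one z hε (D + X')
  have hS := norm_sideResolvent_le (τ := τ) D z hε hg a b X
  have hu := norm_bold_le X i j c
  set h := ‖X i j‖ + ‖X j i‖ with hh
  have hh0 : 0 ≤ h := by positivity
  have hsum := mul_bold_removePair_mul_apply hij X (resolvent (quat z ε) (D + X'))
    (sideResolvent D z ε τ g a b X') (j, c) (i, c)
  rw [← hX'] at hsum
  set Y := discrepancy D z ε τ g X a b
  set Y' := discrepancy D z ε τ g X' a b
  set R' := resolvent (quat z ε) (D + X') with hR'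
  set S := sideResolvent D z ε τ g a b X with hSdef
  set S' := sideResolvent D z ε τ g a b X' with hSdef'
  set u := bold X (i, c) (j, c)
  set B := bold (X - X')
  have hd : S - S' = -(R' * B * S) := by
    rw [hSdef, hSdef', sideResolvent, sideResolvent, ← sub_mul, ← neg_sub (resolvent _ _),
      resolvent_sub_resolvent_same hε0, show D + X - (D + X') = X - X' by abel]
    simp only [Matrix.mul_assoc, neg_mul]
    rfl
  -- The first-order resolvent expansion is iterated once: `S = S' - R' B S' + R' B R' B S`, with an
  -- exact remainder quadratic in `B`.
  have hd2 : S - S' + R' * B * S' = R' * B * R' * B * S := by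
    have h2 : S' = S + R' * B * S := by
      rw [← sub_neg_eq_add, ← hd]; abel
    calc S - S' + R' * B * S' = -(R' * B * S) + R' * B * (S + R' * B * S) := by rw [hd, ← h2]
      _ = R' * B * R' * B * S := by rw [mul_add]; simp only [Matrix.mul_assoc]; abel
  have hq : ‖R' * B * R' * B * S‖ ≤ 16 * h ^ 2 := by
    have h1 : ‖R' * B‖ ≤ 4 * h :=
      (norm_mul_le _ _).trans ((mul_le_of_le_one_left (norm_nonneg _) hRe).trans hA)
    calc ‖R' * B * R' * B * S‖ = ‖(R' * B) * ((R' * B) * S)‖ := by simp only [Matrix.mul_assoc]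
      _ ≤ 4 * h * (4 * h * 1) := (norm_mul_le _ _).trans (mul_le_mul h1 ((norm_mul_le _ _).trans
          (mul_le_mul h1 hS (norm_nonneg _) (by positivity))) (norm_nonneg _) (by positivity))
      _ = _ := by ring
  -- Two errors remain: replacing `Y'` by `Y`, of size `h² / N`, and the quadratic remainder times
  -- `u`, of size `h³`.
  have e : u * S (j, c) (i, c) * star Y -
      (u * (S' (j, c) (i, c) * star Y') -
       ∑ d : Fin 2, (u * bold X (i, d) (j, d) * (R' (j, c) (i, d) * S' (j, d) (i, c) * star Y') +
         u * bold X (j, d) (i, d) * (R' (j, c) (j, d) * S' (i, d) (i, c) * star Y'))) =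
      u * S (j, c) (i, c) * star (Y - Y') +
        u * (R' * B * R' * B * S) (j, c) (i, c) * star Y' := by
    rw [← hd2, Matrix.add_apply, Matrix.sub_apply, hsum, star_sub]
    simp only [Fin.sum_univ_two]
    ring
  rw [e]
  refine (norm_add_le _ _).trans (add_le_add ?_ ?_)
  · rw [norm_mul, norm_mul, norm_star]
    calc ‖u‖ * ‖S (j, c) (i, c)‖ * ‖Y - Y'‖ ≤ h * 1 * (44 * (N : ℝ)⁻¹ * h) := by
          have := (norm_entry_le S (j, c) (i, c)).trans hS
          gcongr
      _ = _ := by ring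
  · rw [norm_mul, norm_mul, norm_star]
    calc _ ≤ h * (16 * h ^ 2) * 4 := by
          have := (norm_entry_le (R' * B * R' * B * S) (j, c) (i, c)).trans hq
          gcongr
      _ = _ := by ring

/-- Removing a pair of entries from a product of resolvent entries and the discrepancy. -/
lemma norm_triple_sub_removePair_le (hε : 1 ≤ ε) (hg : g ∈ closedHalfSpace) (hg1 : ‖g‖ ≤ 1)
    (hτ0 : 0 ≤ τ) (hτ1 : τ ≤ 1) {i j : Fin N} (hij : i ≠ j) (X : Matrix (Fin N) (Fin N) ℂ)
    (a b : Fin 2) (v w v' w' : Fin N × Fin 2) :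
    ‖resolvent (quat z ε) (D + removePair i j X) v w *
        sideResolvent D z ε τ g a b (removePair i j X) v' w' *
        star (discrepancy D z ε τ g (removePair i j X) a b) -
      resolvent (quat z ε) (D + X) v w * sideResolvent D z ε τ g a b X v' w' *
        star (discrepancy D z ε τ g X a b)‖ ≤ 76 * (‖X i j‖ + ‖X j i‖) := by
  have hε0 : 0 < ε := by linarith
  set X' := removePair i j X with hX'
  have hY := (norm_entry_le _ a b).trans (norm_discrepancy_le D z hε hg hg1 hτ0 hτ1 X)
  have hYY := norm_discrepancy_sub_removePair_le D z hε hg hg1 hτ0 hτ1 hij X a b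
  rw [← hX'] at hYY
  have hA := norm_bold_removePair_le hij X
  rw [← hX'] at hA
  have hR' := norm_resolvent_le_one z hε (D + X')
  have hR := norm_resolvent_le_one z hε (D + X)
  have hS := norm_sideResolvent_le (τ := τ) D z hε hg a b X
  have hS' := norm_sideResolvent_le (τ := τ) D z hε hg a b X'
  have hRR := resolvent_sub_resolvent_same (z := z) hε0 (D + X') (D + X)
  have hSS : sideResolvent D z ε τ g a b X' - sideResolvent D z ε τ g a b X =
      resolvent (quat z ε) (D + X') * bold (X - X') * sideResolvent D z ε τ g a b X := by
    rw [sideResolvent, sideResolvent, ← sub_mul, hRR, show D + X - (D + X') = X - X' by abel]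
    simp only [Matrix.mul_assoc]
  rw [show D + X - (D + X') = X - X' by abel] at hRR
  set h := ‖X i j‖ + ‖X j i‖ with hh
  have hh0 : 0 ≤ h := by positivity
  have hprod (P Q : Matrix (Fin N × Fin 2) (Fin N × Fin 2) ℂ) (hP : ‖P‖ ≤ 1) (hQ : ‖Q‖ ≤ 1) :
      ‖P * bold (X - X') * Q‖ ≤ 4 * h :=
    (norm_mul_le _ _).trans ((mul_le_of_le_one_right (norm_nonneg _) hQ).trans
      ((norm_mul_le _ _).trans ((mul_le_of_le_one_left (norm_nonneg _) hP).trans hA)))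
  have b1 := hprod _ _ hR' hR
  have b2 := hprod _ _ hR' hS
  rw [← hRR] at b1
  rw [← hSS] at b2
  -- The gain `1 / N` is dropped here, since the resolvent entries themselves change by order `h`.
  have hN : (N : ℝ)⁻¹ ≤ 1 := by
    have : 1 ≤ N := Nat.one_le_iff_ne_zero.2 fun h => by subst h; exact i.elim0
    exact inv_le_one_of_one_le₀ (by exact_mod_cast this)
  have b3 : ‖discrepancy D z ε τ g X a b - discrepancy D z ε τ g X' a b‖ ≤ 44 * h := by
    refine hYY.trans (mul_le_mul_of_nonneg_right (by linarith) hh0)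
  set Y := discrepancy D z ε τ g X a b
  set Y' := discrepancy D z ε τ g X' a b
  set R := resolvent (quat z ε) (D + X)
  set R' := resolvent (quat z ε) (D + X')
  set S := sideResolvent D z ε τ g a b X
  set S' := sideResolvent D z ε τ g a b X'
  have e : R' v w * S' v' w' * star Y' - R v w * S v' w' * star Y =
      R' v w * S' v' w' * -star (Y - Y') + R' v w * (S' - S) v' w' * star Y +
        (R' - R) v w * S v' w' * star Y := by
    simp only [Matrix.sub_apply, star_sub]; ring
  rw [e]
  have c1 := (norm_entry_le R' v w).trans hR'
  have c2 := (norm_entry_le S' v' w').trans hS'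
  have c3 := (norm_entry_le S v' w').trans hS
  have c4 := (norm_entry_le (R' - R) v w).trans b1
  have c5 := (norm_entry_le (S' - S) v' w').trans b2
  have d1 : ‖R' v w * S' v' w' * -star (Y - Y')‖ ≤ 1 * 1 * (44 * h) := by
    rw [norm_mul, norm_mul, norm_neg, norm_star]; gcongr
  have d2 : ‖R' v w * (S' - S) v' w' * star Y‖ ≤ 1 * (4 * h) * 4 := by
    rw [norm_mul, norm_mul, norm_star]; gcongr
  have d3 : ‖(R' - R) v w * S v' w' * star Y‖ ≤ 4 * h * 1 * 4 := by
    rw [norm_mul, norm_mul, norm_star]; gcongr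
  refine (norm_add_le_of_le (norm_add_le_of_le d1 d2) d3).trans (le_of_eq (by ring))

end Expansion

end QuatGreen

namespace QuatGreen

open Matrix

/-! ### Elliptic random matrices and their moments -/

section RandomMatrix

variable {Ω : Type*} [MeasurableSpace Ω] {P : Measure Ω} {N : ℕ}

/-- A random matrix with centred entries of variance `r ^ 2`, third absolute moment at most
`C * r ^ 3` and covariance `τ * r ^ 2` between transposed entries, each pair of transposed
entries being independent of all the others. -/
structure IsEllipticEnsemble (P : Measure Ω) (X : Ω → Matrix (Fin N) (Fin N) ℂ) (τ r C : ℝ) : Prop where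
  measurable_entry : ∀ i j, Measurable fun ω => X ω i j
  integral_entry : ∀ i j, ∫ ω, X ω i j ∂P = 0
  integrable_sq : ∀ i j, Integrable (fun ω => ‖X ω i j‖ ^ 2) P
  integral_sq : ∀ i j, ∫ ω, ‖X ω i j‖ ^ 2 ∂P = r ^ 2
  integrable_cube : ∀ i j, Integrable (fun ω => ‖X ω i j‖ ^ 3) P
  integral_cube : ∀ i j, ∫ ω, ‖X ω i j‖ ^ 3 ∂P ≤ C * r ^ 3
  integral_mul_transpose : ∀ i j, i ≠ j → ∫ ω, X ω i j * X ω j i ∂P = (τ : ℂ) * (r : ℂ) ^ 2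
  indep : ∀ i j, i ≠ j → IndepFun (γ := Fin N → Fin N → ℂ) (fun ω => (X ω i j, X ω j i))
    (fun ω => removePair i j (X ω)) P

namespace IsEllipticEnsemble

variable {X : Ω → Matrix (Fin N) (Fin N) ℂ} {τ r C : ℝ}

lemma measurable_of_continuous_matrix {F : Matrix (Fin N) (Fin N) ℂ → ℂ} (hF : Continuous F) :
    @Measurable (Fin N → Fin N → ℂ) ℂ _ _ F := by
  have h : @Continuous (Fin N → Fin N → ℂ) ℂ _ _ F := hF
  exact h.measurable

lemma measurable_comp (hX : IsEllipticEnsemble P X τ r C) {F : Matrix (Fin N) (Fin N) ℂ → ℂ}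
    (hF : Continuous F) : Measurable fun ω => F (X ω) := by
  have h : @Measurable Ω (Fin N → Fin N → ℂ) _ _ X :=
    measurable_pi_iff.2 fun i => measurable_pi_iff.2 fun j => hX.measurable_entry i j
  exact (measurable_of_continuous_matrix hF).comp h

lemma continuous_removePair (i j : Fin N) : Continuous (removePair i j) := by
  refine continuous_matrix fun k l => ?_
  simp only [removePair, Matrix.of_apply]
  split_ifs
  · exact continuous_const
  · exact continuous_id.matrix_elem k l

lemma integrable_entry [IsProbabilityMeasure P] (hX : IsEllipticEnsemble P X τ r C) (i j : Fin N) :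
    Integrable (fun ω => ‖X ω i j‖) P := by
  refine ((integrable_const (1 : ℝ)).add (hX.integrable_sq i j)).mono'
    (hX.measurable_entry i j).norm.aestronglyMeasurable (ae_of_all _ fun ω => ?_)
  simp only [norm_norm, Pi.add_apply]
  nlinarith [sq_nonneg (‖X ω i j‖ - 1), norm_nonneg (X ω i j)]

lemma integral_norm_le [IsProbabilityMeasure P] (hX : IsEllipticEnsemble P X τ r C) (hr : 0 < r) (i j : Fin N) :
    ∫ ω, ‖X ω i j‖ ∂P ≤ r := by
  -- Young's inequality weighted so that, for second moment `r ^ 2`, each term contributes `r / 2`.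
  have h : ∫ ω, ‖X ω i j‖ ∂P ≤ ∫ ω, (r / 2 + (2 * r)⁻¹ * ‖X ω i j‖ ^ 2) ∂P := by
    refine integral_mono (hX.integrable_entry i j)
      ((integrable_const _).add ((hX.integrable_sq i j).const_mul _)) fun ω => ?_
    change ‖X ω i j‖ ≤ r / 2 + (2 * r)⁻¹ * ‖X ω i j‖ ^ 2
    have e : r / 2 + (2 * r)⁻¹ * ‖X ω i j‖ ^ 2 - ‖X ω i j‖ =
        (2 * r)⁻¹ * (r - ‖X ω i j‖) ^ 2 := by field_simp; ring
    have : 0 ≤ (2 * r)⁻¹ * (r - ‖X ω i j‖) ^ 2 := by positivity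
    linarith
  rw [integral_add (integrable_const _) ((hX.integrable_sq i j).const_mul _), integral_const_mul,
    hX.integral_sq] at h
  refine h.trans (le_of_eq ?_)
  simp
  field_simp
  ring

lemma integrable_mul (hX : IsEllipticEnsemble P X τ r C) {u v : Ω → ℂ} (hu : Measurable u)
    (hv : Measurable v) {i j k l : Fin N} (hu' : ∀ ω, ‖u ω‖ = ‖X ω i j‖)
    (hv' : ∀ ω, ‖v ω‖ = ‖X ω k l‖) : Integrable (fun ω => u ω * v ω) P := by
  refine (((hX.integrable_sq i j).add (hX.integrable_sq k l))).mono'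
    (hu.mul hv).aestronglyMeasurable (ae_of_all _ fun ω => ?_)
  simp only [norm_mul, hu', hv', Pi.add_apply]
  nlinarith [sq_nonneg (‖X ω i j‖ - ‖X ω k l‖), sq_nonneg (‖X ω i j‖ + ‖X ω k l‖)]

lemma norm_integral_mul_le (hX : IsEllipticEnsemble P X τ r C) {u v : Ω → ℂ}
    {i j k l : Fin N} (hu' : ∀ ω, ‖u ω‖ = ‖X ω i j‖)
    (hv' : ∀ ω, ‖v ω‖ = ‖X ω k l‖) : ‖∫ ω, u ω * v ω ∂P‖ ≤ r ^ 2 := by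
  have h : ‖∫ ω, u ω * v ω ∂P‖ ≤ ∫ ω, (1 / 2 * ‖X ω i j‖ ^ 2 + 1 / 2 * ‖X ω k l‖ ^ 2) ∂P := by
    refine norm_integral_le_of_norm_le
      (((hX.integrable_sq i j).const_mul _).add ((hX.integrable_sq k l).const_mul _))
      (ae_of_all _ fun ω => ?_)
    simp only [norm_mul, hu', hv']
    nlinarith [sq_nonneg (‖X ω i j‖ - ‖X ω k l‖)]
  rw [integral_add ((hX.integrable_sq i j).const_mul _) ((hX.integrable_sq k l).const_mul _),
    integral_const_mul, integral_const_mul, hX.integral_sq, hX.integral_sq] at h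
  linarith

lemma integral_bold (hX : IsEllipticEnsemble P X τ r C) (i j : Fin N) (c : Fin 2) :
    ∫ ω, bold (X ω) (i, c) (j, c) ∂P = 0 := by
  fin_cases c
  · simpa [bold] using hX.integral_entry i j
  · have := integral_conj (μ := P) (f := fun ω => X ω j i)
    simp only [bold]
    simpa [hX.integral_entry j i] using this

/-- Equal block coordinates give `E X_ij X_ji` or its conjugate, and different ones give a variance.
This is the probabilistic origin of `t = τ + j`. -/
lemma integral_bold_mul_transpose (hX : IsEllipticEnsemble P X τ r C) {i j : Fin N} (hij : i ≠ j)
    (c d : Fin 2) : ∫ ω, bold (X ω) (i, c) (j, c) * bold (X ω) (j, d) (i, d) ∂P =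
      coupling τ c d * (r : ℂ) ^ 2 := by
  have hsq (k l : Fin N) : ∫ ω, ((‖X ω k l‖ : ℂ)) ^ 2 ∂P = (r : ℂ) ^ 2 := by
    have := integral_ofReal (𝕜 := ℂ) (μ := P) (f := fun ω => ‖X ω k l‖ ^ 2)
    rw [hX.integral_sq] at this
    simpa using this
  have hconj := integral_conj (μ := P) (f := fun ω => X ω i j * X ω j i)
  rw [hX.integral_mul_transpose i j hij] at hconj
  fin_cases c <;> fin_cases d
  · simpa [bold, coupling] using hX.integral_mul_transpose i j hij
  · simpa [bold, coupling, Complex.mul_conj'] using hsq i j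
  · simpa [bold, coupling, Complex.conj_mul'] using hsq j i
  · simpa [bold, coupling, mul_comm] using hconj

/-- All uses of independence go through this factorisation. -/
lemma integral_mul_removePair (hX : IsEllipticEnsemble P X τ r C) {i j : Fin N} (hij : i ≠ j)
    {φ : ℂ × ℂ → ℂ} (hφ : Measurable φ) {F : Matrix (Fin N) (Fin N) ℂ → ℂ} (hF : Continuous F) :
    ∫ ω, φ (X ω i j, X ω j i) * F (removePair i j (X ω)) ∂P =
      (∫ ω, φ (X ω i j, X ω j i) ∂P) * ∫ ω, F (removePair i j (X ω)) ∂P := by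
  have h2 := (hX.indep i j hij).comp hφ (measurable_of_continuous_matrix hF)
  exact h2.integral_fun_mul_eq_mul_integral
    (hφ.comp ((hX.measurable_entry i j).prodMk (hX.measurable_entry j i))).aestronglyMeasurable
    (hX.measurable_comp (hF.comp (continuous_removePair i j))).aestronglyMeasurable

/-- The entry `(i, c), (j, c)` of the doubled matrix, as a function of a transposed pair. -/
noncomputable def pairEntry (c : Fin 2) (x : ℂ × ℂ) : ℂ := ![x.1, (starRingEnd ℂ) x.2] c

lemma measurable_pairEntry (c : Fin 2) : Measurable (pairEntry c) := by
  fin_cases c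
  · exact measurable_fst
  · exact Complex.continuous_conj.measurable.comp measurable_snd

lemma bold_eq_pairEntry (X : Matrix (Fin N) (Fin N) ℂ) (i j : Fin N) (c : Fin 2) :
    bold X (i, c) (j, c) = pairEntry c (X i j, X j i) := by
  fin_cases c <;> simp [bold, pairEntry]

lemma measurable_bold (hX : IsEllipticEnsemble P X τ r C) (i j : Fin N) (c : Fin 2) :
    Measurable fun ω => bold (X ω) (i, c) (j, c) := by
  simp only [bold_eq_pairEntry]
  exact (measurable_pairEntry c).comp
    ((hX.measurable_entry i j).prodMk (hX.measurable_entry j i))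

lemma integral_pow_sum_le [IsProbabilityMeasure P] (hX : IsEllipticEnsemble P X τ r C) (hr : 0 < r) (i j : Fin N) :
    (Integrable (fun ω => ‖X ω i j‖ + ‖X ω j i‖) P ∧
      ∫ ω, (‖X ω i j‖ + ‖X ω j i‖) ∂P ≤ 2 * r) ∧
    (Integrable (fun ω => (‖X ω i j‖ + ‖X ω j i‖) ^ 2) P ∧
      ∫ ω, (‖X ω i j‖ + ‖X ω j i‖) ^ 2 ∂P ≤ 4 * r ^ 2) ∧
    (Integrable (fun ω => (‖X ω i j‖ + ‖X ω j i‖) ^ 3) P ∧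
      ∫ ω, (‖X ω i j‖ + ‖X ω j i‖) ^ 3 ∂P ≤ 8 * C * r ^ 3) := by
  have hm : Measurable fun ω => ‖X ω i j‖ + ‖X ω j i‖ :=
    (hX.measurable_entry i j).norm.add (hX.measurable_entry j i).norm
  have i2 : Integrable (fun ω => 2 * ‖X ω i j‖ ^ 2 + 2 * ‖X ω j i‖ ^ 2) P :=
    ((hX.integrable_sq i j).const_mul _).add ((hX.integrable_sq j i).const_mul _)
  have i3 : Integrable (fun ω => 4 * ‖X ω i j‖ ^ 3 + 4 * ‖X ω j i‖ ^ 3) P :=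
    ((hX.integrable_cube i j).const_mul _).add ((hX.integrable_cube j i).const_mul _)
  have b2 (ω : Ω) : (‖X ω i j‖ + ‖X ω j i‖) ^ 2 ≤ 2 * ‖X ω i j‖ ^ 2 + 2 * ‖X ω j i‖ ^ 2 := by
    nlinarith [sq_nonneg (‖X ω i j‖ - ‖X ω j i‖)]
  have b3 (ω : Ω) : (‖X ω i j‖ + ‖X ω j i‖) ^ 3 ≤ 4 * ‖X ω i j‖ ^ 3 + 4 * ‖X ω j i‖ ^ 3 := by
    nlinarith [mul_nonneg (add_nonneg (norm_nonneg (X ω i j)) (norm_nonneg (X ω j i)))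
      (sq_nonneg (‖X ω i j‖ - ‖X ω j i‖))]
  have j2 : Integrable (fun ω => (‖X ω i j‖ + ‖X ω j i‖) ^ 2) P :=
    i2.mono' (hm.pow_const 2).aestronglyMeasurable (ae_of_all _ fun ω => by
      rw [Real.norm_of_nonneg (by positivity)]; exact b2 ω)
  have j3 : Integrable (fun ω => (‖X ω i j‖ + ‖X ω j i‖) ^ 3) P :=
    i3.mono' (hm.pow_const 3).aestronglyMeasurable (ae_of_all _ fun ω => by
      rw [Real.norm_of_nonneg (by positivity)]; exact b3 ω)
  refine ⟨⟨(hX.integrable_entry i j).add (hX.integrable_entry j i), ?_⟩, ⟨j2, ?_⟩, ⟨j3, ?_⟩⟩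
  · rw [integral_add (hX.integrable_entry i j) (hX.integrable_entry j i)]
    linarith [hX.integral_norm_le hr i j, hX.integral_norm_le hr j i]
  · refine (integral_mono j2 i2 b2).trans ?_
    rw [integral_add ((hX.integrable_sq i j).const_mul _) ((hX.integrable_sq j i).const_mul _),
      integral_const_mul, integral_const_mul, hX.integral_sq, hX.integral_sq]
    linarith
  · refine (integral_mono j3 i3 b3).trans ?_
    rw [integral_add ((hX.integrable_cube i j).const_mul _) ((hX.integrable_cube j i).const_mul _),
      integral_const_mul, integral_const_mul]
    linarith [hX.integral_cube i j, hX.integral_cube j i]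

end IsEllipticEnsemble

end RandomMatrix

end QuatGreen

namespace QuatGreen

open Matrix

/-! ### Continuity of the entries of the expansion -/

section SideContinuity

variable {N : ℕ} (D : Matrix (Fin N) (Fin N) ℂ) (z : ℂ) {ε : ℝ}

lemma continuous_resolvent_entry (hε : 0 < ε) (x y : Fin N × Fin 2) :
    Continuous fun X : Matrix (Fin N) (Fin N) ℂ => resolvent (quat z ε) (D + X) x y :=
  (continuous_resolvent_add D z hε).matrix_elem x y

lemma continuous_sideResolvent_entry (hε : 0 < ε) (τ : ℝ) (g : ℍ[ℝ]) (a b : Fin 2)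
    (x y : Fin N × Fin 2) :
    Continuous fun X : Matrix (Fin N) (Fin N) ℂ => sideResolvent D z ε τ g a b X x y :=
  ((continuous_resolvent_add D z hε).matrix_mul continuous_const).matrix_elem x y

end SideContinuity

open scoped Matrix.Norms.L2Operator

/-! ### Expectation of one off-diagonal summand -/

section SecondMoment

/-- Each of the `2N` columns of a contraction has ℓ² norm at most one, and `x y ≤ (x² + y²) / 2`.
Bounding the terms one by one would give only order `N²`. -/
lemma sum_norm_mul_norm_le {N : ℕ} {R S : Matrix (Fin N × Fin 2) (Fin N × Fin 2) ℂ} (hR : ‖R‖ ≤ 1)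
    (hS : ‖S‖ ≤ 1) :
    ∑ i : Fin N, ∑ j : Fin N, ∑ c : Fin 2, ∑ d : Fin 2, ‖R (j, c) (i, d)‖ * ‖S (j, d) (i, c)‖ ≤
      2 * N := by
  have key (B : Matrix (Fin N × Fin 2) (Fin N × Fin 2) ℂ) (hB : ‖B‖ ≤ 1) :
      ∑ i : Fin N, ∑ d : Fin 2, ∑ j : Fin N, ∑ c : Fin 2, ‖B (j, c) (i, d)‖ ^ 2 ≤ 2 * N := by
    have h (y : Fin N × Fin 2) : ∑ j : Fin N, ∑ c : Fin 2, ‖B (j, c) y‖ ^ 2 ≤ 1 := by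
      rw [← Fintype.sum_prod_type (f := fun x : Fin N × Fin 2 => ‖B x y‖ ^ 2)]
      exact (sum_sq_norm_col_le B y).trans (pow_le_one₀ (norm_nonneg _) hB)
    calc _ ≤ ∑ i : Fin N, ∑ d : Fin 2, (1 : ℝ) :=
          Finset.sum_le_sum fun i _ => Finset.sum_le_sum fun d _ => h (i, d)
      _ = 2 * N := by simp; ring
  have h1 : ∑ i : Fin N, ∑ j : Fin N, ∑ c : Fin 2, ∑ d : Fin 2,
      ‖R (j, c) (i, d)‖ * ‖S (j, d) (i, c)‖ ≤
      ∑ i : Fin N, ∑ j : Fin N, ∑ c : Fin 2, ∑ d : Fin 2,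
        (1 / 2 * ‖R (j, c) (i, d)‖ ^ 2 + 1 / 2 * ‖S (j, d) (i, c)‖ ^ 2) := by
    refine Finset.sum_le_sum fun i _ => Finset.sum_le_sum fun j _ => Finset.sum_le_sum fun c _ =>
      Finset.sum_le_sum fun d _ => ?_
    nlinarith [sq_nonneg (‖R (j, c) (i, d)‖ - ‖S (j, d) (i, c)‖)]
  have h2 : ∑ i : Fin N, ∑ j : Fin N, ∑ c : Fin 2, ∑ d : Fin 2,
        (1 / 2 * ‖R (j, c) (i, d)‖ ^ 2 + 1 / 2 * ‖S (j, d) (i, c)‖ ^ 2) =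
      1 / 2 * (∑ i : Fin N, ∑ d : Fin 2, ∑ j : Fin N, ∑ c : Fin 2, ‖R (j, c) (i, d)‖ ^ 2) +
      1 / 2 * (∑ i : Fin N, ∑ d : Fin 2, ∑ j : Fin N, ∑ c : Fin 2, ‖S (j, c) (i, d)‖ ^ 2) := by
    simp only [Fin.sum_univ_two, Finset.mul_sum, Finset.sum_add_distrib, mul_add]
    ring
  rw [h2] at h1
  linarith [key R hR, key S hS]

variable {Ω : Type*} [MeasurableSpace Ω] {P : Measure Ω} [IsProbabilityMeasure P] {N : ℕ}
  {X : Ω → Matrix (Fin N) (Fin N) ℂ} {τ r C : ℝ}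

omit [IsProbabilityMeasure P] in
lemma integrable_mul_bounded {u f : Ω → ℂ} (hu : Integrable u P) (hf : Measurable f) (K : ℝ)
    (hK : ∀ ω, ‖f ω‖ ≤ K) : Integrable (fun ω => u ω * f ω) P :=
  hu.mul_bdd hf.aestronglyMeasurable (ae_of_all _ hK)

lemma integrable_of_bounded {f : Ω → ℂ} (hf : Measurable f) (K : ℝ)
    (hK : ∀ ω, ‖f ω‖ ≤ K) : Integrable f P :=
  (integrable_const K).mono' hf.aestronglyMeasurable (ae_of_all _ hK)

namespace IsEllipticEnsemble

lemma integrable_bold (hX : IsEllipticEnsemble P X τ r C) (i j : Fin N) (c : Fin 2) :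
    Integrable (fun ω => bold (X ω) (i, c) (j, c)) P :=
  ((hX.integrable_entry i j).add (hX.integrable_entry j i)).mono'
    (hX.measurable_bold i j c).aestronglyMeasurable (ae_of_all _ fun _ => norm_bold_le _ i j c)

lemma exists_norm_bold_eq (i j : Fin N) (c : Fin 2) :
    ∃ k l : Fin N, ∀ X : Matrix (Fin N) (Fin N) ℂ, ‖bold X (i, c) (j, c)‖ = ‖X k l‖ := by
  fin_cases c
  · exact ⟨i, j, fun X => by simp [bold]⟩
  · exact ⟨j, i, fun X => by simp [bold]⟩

variable (D : Matrix (Fin N) (Fin N) ℂ) (z : ℂ) {ε : ℝ} {g : ℍ[ℝ]}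

lemma norm_integral_offDiag_le (hX : IsEllipticEnsemble P X τ r C) (hr : 0 < r) (hr1 : r ≤ 1)
    (hNr : (N : ℝ)⁻¹ = r ^ 2) (hε : 1 ≤ ε) (hg : g ∈ closedHalfSpace) (hg1 : ‖g‖ ≤ 1)
    (hτ0 : 0 ≤ τ) (hτ1 : τ ≤ 1) {i j : Fin N} (hij : i ≠ j) (a b c : Fin 2) :
    ‖∫ ω, (bold (X ω) (i, c) (j, c) * sideResolvent D z ε τ g a b (X ω) (j, c) (i, c) +
        (N : ℂ)⁻¹ * ∑ d : Fin 2, coupling τ c d *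
          (resolvent (quat z ε) (D + X ω) (j, c) (j, d) *
            sideResolvent D z ε τ g a b (X ω) (i, d) (i, c))) *
        star (discrepancy D z ε τ g (X ω) a b) ∂P‖ ≤
      (784 + 512 * C) * r ^ 3 + 4 * r ^ 2 * ∑ d : Fin 2,
        ∫ ω, ‖resolvent (quat z ε) (D + X ω) (j, c) (i, d)‖ *
          ‖sideResolvent D z ε τ g a b (X ω) (j, d) (i, c)‖ ∂P := by
  have hε0 : 0 < ε := by linarith
  set S := sideResolvent D z ε τ g a b with hS
  set R : Matrix (Fin N) (Fin N) ℂ → _ := fun M => resolvent (quat z ε) (D + M) with hR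
  set Y : Matrix (Fin N) (Fin N) ℂ → ℂ := fun M => star (discrepancy D z ε τ g M a b) with hY
  have cS (x y) : Continuous fun M => S M x y := continuous_sideResolvent_entry D z hε0 τ g a b x y
  have cR (x y) : Continuous fun M => R M x y := continuous_resolvent_entry D z hε0 x y
  have cY : Continuous Y := (continuous_discrepancy D z hε0 τ g a b).star
  have bS (M x y) : ‖S M x y‖ ≤ 1 :=
    (norm_entry_le _ _ _).trans (norm_sideResolvent_le D z hε hg a b M)
  have bR (M x y) : ‖R M x y‖ ≤ 1 :=
    (norm_entry_le _ _ _).trans (norm_resolvent_le_one z hε _)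
  have bY (M) : ‖Y M‖ ≤ 4 := by
    rw [hY, norm_star]
    exact (norm_entry_le _ _ _).trans (norm_discrepancy_le D z hε hg hg1 hτ0 hτ1 M)
  set F1 : Matrix (Fin N) (Fin N) ℂ → ℂ := fun M => S M (j, c) (i, c) * Y M with hF1
  set F : Fin 2 → Matrix (Fin N) (Fin N) ℂ → ℂ :=
    fun d M => R M (j, c) (i, d) * S M (j, d) (i, c) * Y M with hF
  set G : Fin 2 → Matrix (Fin N) (Fin N) ℂ → ℂ :=
    fun d M => R M (j, c) (j, d) * S M (i, d) (i, c) * Y M with hG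
  have cF1 : Continuous F1 := (cS _ _).mul cY
  have cF (d) : Continuous (F d) := ((cR _ _).mul (cS _ _)).mul cY
  have cG (d) : Continuous (G d) := ((cR _ _).mul (cS _ _)).mul cY
  have bF1 (M) : ‖F1 M‖ ≤ 4 := by
    have h1 := bS M (j, c) (i, c)
    have h2 := bY M
    calc ‖F1 M‖ ≤ 1 * 4 := by rw [hF1, norm_mul]; gcongr
      _ = 4 := by norm_num
  have b3 {x y w : ℂ} (hx : ‖x‖ ≤ 1) (hy : ‖y‖ ≤ 1) (hw : ‖w‖ ≤ 4) : ‖x * y * w‖ ≤ 4 := by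
    calc ‖x * y * w‖ ≤ 1 * 1 * 4 := by rw [norm_mul, norm_mul]; gcongr
      _ = 4 := by norm_num
  have bF (d M) : ‖F d M‖ ≤ 4 := b3 (bR _ _ _) (bS _ _ _) (bY _)
  have bG (d M) : ‖G d M‖ ≤ 4 := b3 (bR _ _ _) (bS _ _ _) (bY _)
  set X' : Ω → Matrix (Fin N) (Fin N) ℂ := fun ω => removePair i j (X ω) with hX'
  have mX {H : Matrix (Fin N) (Fin N) ℂ → ℂ} (hH : Continuous H) : Measurable fun ω => H (X ω) :=
    hX.measurable_comp hH
  have mX' {H : Matrix (Fin N) (Fin N) ℂ → ℂ} (hH : Continuous H) :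
      Measurable fun ω => H (X' ω) :=
    hX.measurable_comp (hH.comp (continuous_removePair i j))
  set h : Ω → ℝ := fun ω => ‖X ω i j‖ + ‖X ω j i‖ with hh
  obtain ⟨⟨ih1, eh1⟩, ⟨ih2, eh2⟩, ih3, eh3⟩ := hX.integral_pow_sum_le hr i j
  set u : Ω → ℂ := fun ω => bold (X ω) (i, c) (j, c) with hu
  set v1 : Fin 2 → Ω → ℂ := fun d ω => bold (X ω) (i, d) (j, d) with hv1
  set v2 : Fin 2 → Ω → ℂ := fun d ω => bold (X ω) (j, d) (i, d) with hv2
  have iu : Integrable u P := hX.integrable_bold i j c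
  obtain ⟨k, l, hkl⟩ := exists_norm_bold_eq i j c
  have iuv1 (d) : Integrable (fun ω => u ω * v1 d ω) P := by
    obtain ⟨k', l', hkl'⟩ := exists_norm_bold_eq i j d
    exact hX.integrable_mul (hX.measurable_bold i j c) (hX.measurable_bold i j d)
      (fun ω => hkl (X ω)) (fun ω => hkl' (X ω))
  have iuv2 (d) : Integrable (fun ω => u ω * v2 d ω) P := by
    obtain ⟨k', l', hkl'⟩ := exists_norm_bold_eq j i d
    exact hX.integrable_mul (hX.measurable_bold i j c) (hX.measurable_bold j i d)
      (fun ω => hkl (X ω)) (fun ω => hkl' (X ω))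
  have nuv1 (d) : ‖∫ ω, u ω * v1 d ω ∂P‖ ≤ r ^ 2 := by
    obtain ⟨k', l', hkl'⟩ := exists_norm_bold_eq i j d
    exact hX.norm_integral_mul_le (fun ω => hkl (X ω)) (fun ω => hkl' (X ω))
  -- independence
  have e1 : ∫ ω, u ω * F1 (X' ω) ∂P = 0 := by
    have := hX.integral_mul_removePair hij (measurable_pairEntry c) cF1
    simp only [← bold_eq_pairEntry] at this
    rw [hX.integral_bold, zero_mul] at this
    exact this
  have e2 (d) : ∫ ω, u ω * v1 d ω * F d (X' ω) ∂P =
      (∫ ω, u ω * v1 d ω ∂P) * ∫ ω, F d (X' ω) ∂P := by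
    have := hX.integral_mul_removePair hij
      ((measurable_pairEntry c).mul (measurable_pairEntry d)) (cF d)
    simp only [Pi.mul_apply, ← bold_eq_pairEntry] at this
    exact this
  have e3 (d) : ∫ ω, u ω * v2 d ω * G d (X' ω) ∂P =
      (coupling τ c d * (r : ℂ) ^ 2) * ∫ ω, G d (X' ω) ∂P := by
    have := hX.integral_mul_removePair hij
      ((measurable_pairEntry c).mul ((measurable_pairEntry d).comp measurable_swap)) (cG d)
    simp only [Pi.mul_apply, Function.comp_apply, Prod.swap_prod_mk, ← bold_eq_pairEntry] at this
    rw [hX.integral_bold_mul_transpose hij] at this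
    exact this
  -- the remainder
  set rem : Ω → ℂ := fun ω => u ω * S (X ω) (j, c) (i, c) * Y (X ω) -
    (u ω * F1 (X' ω) - ∑ d : Fin 2, (u ω * v1 d ω * F d (X' ω) + u ω * v2 d ω * G d (X' ω)))
    with hrem
  have brem (ω) : ‖rem ω‖ ≤ 44 * (N : ℝ)⁻¹ * h ω ^ 2 + 64 * h ω ^ 3 :=
    norm_expansion_le D z hε hg hg1 hτ0 hτ1 hij (X ω) a b c
  have i0 : Integrable (fun ω => u ω * S (X ω) (j, c) (i, c) * Y (X ω)) P := by
    simp only [mul_assoc]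
    exact integrable_mul_bounded iu (mX cF1) 4 fun ω => bF1 _
  have i1 : Integrable (fun ω => u ω * F1 (X' ω)) P :=
    integrable_mul_bounded iu (mX' cF1) 4 fun ω => bF1 _
  have i2 (d) : Integrable (fun ω => u ω * v1 d ω * F d (X' ω)) P :=
    integrable_mul_bounded (iuv1 d) (mX' (cF d)) 4 fun ω => bF d _
  have i3 (d) : Integrable (fun ω => u ω * v2 d ω * G d (X' ω)) P :=
    integrable_mul_bounded (iuv2 d) (mX' (cG d)) 4 fun ω => bG d _
  have i23d (d) : Integrable (fun ω =>
      u ω * v1 d ω * F d (X' ω) + u ω * v2 d ω * G d (X' ω)) P := (i2 d).add (i3 d)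
  have i23 : Integrable (fun ω => ∑ d : Fin 2,
      (u ω * v1 d ω * F d (X' ω) + u ω * v2 d ω * G d (X' ω))) P :=
    integrable_finsetSum _ fun d _ => i23d d
  have irem : Integrable rem P := i0.sub (i1.sub i23)
  have iG (d) : Integrable (fun ω => G d (X ω)) P :=
    integrable_of_bounded (mX (cG d)) 4 fun ω => bG d _
  have iG' (d) : Integrable (fun ω => G d (X' ω)) P :=
    integrable_of_bounded (mX' (cG d)) 4 fun ω => bG d _
  have iF (d) : Integrable (fun ω => F d (X ω)) P :=
    integrable_of_bounded (mX (cF d)) 4 fun ω => bF d _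
  have iF' (d) : Integrable (fun ω => F d (X' ω)) P :=
    integrable_of_bounded (mX' (cF d)) 4 fun ω => bF d _
  have nrem : ‖∫ ω, rem ω ∂P‖ ≤ 176 * r ^ 4 + 512 * C * r ^ 3 := by
    have h1 : ‖∫ ω, rem ω ∂P‖ ≤ ∫ ω, (44 * (N : ℝ)⁻¹ * h ω ^ 2 + 64 * h ω ^ 3) ∂P :=
      norm_integral_le_of_norm_le ((ih2.const_mul _).add (ih3.const_mul _)) (ae_of_all _ brem)
    rw [integral_add (ih2.const_mul _) (ih3.const_mul _), integral_const_mul, integral_const_mul,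
      hNr] at h1
    have h2 : 44 * r ^ 2 * ∫ ω, h ω ^ 2 ∂P ≤ 44 * r ^ 2 * (4 * r ^ 2) :=
      mul_le_mul_of_nonneg_left eh2 (by positivity)
    linarith [h1, h2, eh3]
  -- The deleted matrix depends on `(i, j)`. Returning to `X` lets the counterterm cancel and lets
  -- the Hilbert–Schmidt bound be applied to one fixed pair of matrices, at cost `76 * 2 r`.
  have nFG (H : Matrix (Fin N) (Fin N) ℂ → ℂ) (hH : ∀ ω, ‖H (X' ω) - H (X ω)‖ ≤ 76 * h ω)
      (iH : Integrable (fun ω => H (X ω)) P) (iH' : Integrable (fun ω => H (X' ω)) P) :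
      ‖∫ ω, H (X' ω) ∂P - ∫ ω, H (X ω) ∂P‖ ≤ 152 * r := by
    rw [← integral_sub iH' iH]
    refine (norm_integral_le_of_norm_le (ih1.const_mul 76) (ae_of_all _ hH)).trans ?_
    rw [integral_const_mul]
    linarith
  have nF (d) := nFG (F d) (fun ω => norm_triple_sub_removePair_le D z hε hg hg1 hτ0 hτ1 hij (X ω)
    a b (j, c) (i, d) (j, d) (i, c)) (iF d) (iF' d)
  have nG (d) := nFG (G d) (fun ω => norm_triple_sub_removePair_le D z hε hg hg1 hτ0 hτ1 hij (X ω)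
    a b (j, c) (j, d) (i, d) (i, c)) (iG d) (iG' d)
  have nF2 (d) : ‖∫ ω, F d (X ω) ∂P‖ ≤
      4 * ∫ ω, ‖R (X ω) (j, c) (i, d)‖ * ‖S (X ω) (j, d) (i, c)‖ ∂P := by
    rw [← integral_const_mul]
    refine norm_integral_le_of_norm_le ?_ (ae_of_all _ fun ω => ?_)
    · refine Integrable.const_mul ?_ _
      have h1 : Integrable (fun ω => R (X ω) (j, c) (i, d) * S (X ω) (j, d) (i, c)) P :=
        integrable_of_bounded (mX ((cR (j, c) (i, d)).mul (cS (j, d) (i, c)))) 1 fun ω =>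
          (norm_mul_le _ _).trans (mul_le_one₀ (bR _ _ _) (norm_nonneg _) (bS _ _ _))
      exact h1.norm.congr (ae_of_all _ fun ω => norm_mul _ _)
    · have := bY (X ω)
      simp only [hF, norm_mul]
      rw [mul_comm (4 : ℝ)]
      gcongr
  -- assembling
  have hNc : (N : ℂ)⁻¹ = (r : ℂ) ^ 2 := by
    rw [← Complex.ofReal_natCast, ← Complex.ofReal_inv, hNr, Complex.ofReal_pow]
  -- The opposite-position covariances cancel the counterterm up to the difference between `G d` at
  -- `X'` and at `X`.
  have etot : ∫ ω, (u ω * S (X ω) (j, c) (i, c) + (N : ℂ)⁻¹ * ∑ d : Fin 2, coupling τ c d *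
        (R (X ω) (j, c) (j, d) * S (X ω) (i, d) (i, c))) * Y (X ω) ∂P =
      ∫ ω, rem ω ∂P - ∑ d : Fin 2, (∫ ω, u ω * v1 d ω ∂P) * ∫ ω, F d (X' ω) ∂P -
        ∑ d : Fin 2, (r : ℂ) ^ 2 * coupling τ c d *
          (∫ ω, G d (X' ω) ∂P - ∫ ω, G d (X ω) ∂P) := by
    have hrem2 : ∫ ω, rem ω ∂P = ∫ ω, u ω * S (X ω) (j, c) (i, c) * Y (X ω) ∂P -
        (0 - ∑ d : Fin 2, ((∫ ω, u ω * v1 d ω ∂P) * ∫ ω, F d (X' ω) ∂P +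
          (coupling τ c d * (r : ℂ) ^ 2) * ∫ ω, G d (X' ω) ∂P)) := by
      have h1 : ∫ ω, rem ω ∂P = ∫ ω, u ω * S (X ω) (j, c) (i, c) * Y (X ω) ∂P -
        (∫ ω, u ω * F1 (X' ω) ∂P - ∫ ω, ∑ d : Fin 2,
          (u ω * v1 d ω * F d (X' ω) + u ω * v2 d ω * G d (X' ω)) ∂P) := by
        exact (integral_sub i0 (i1.sub i23)).trans (congrArg _ (integral_sub i1 i23))
      rw [h1, e1, integral_finsetSum _ fun d _ => i23d d]
      congr 3
      funext d
      rw [integral_add (i2 d) (i3 d), e2, e3]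
    have h2 : ∫ ω, (u ω * S (X ω) (j, c) (i, c) + (N : ℂ)⁻¹ * ∑ d : Fin 2, coupling τ c d *
        (R (X ω) (j, c) (j, d) * S (X ω) (i, d) (i, c))) * Y (X ω) ∂P =
        ∫ ω, u ω * S (X ω) (j, c) (i, c) * Y (X ω) ∂P +
          ∑ d : Fin 2, (r : ℂ) ^ 2 * coupling τ c d * ∫ ω, G d (X ω) ∂P := by
      have h3 (ω) : (u ω * S (X ω) (j, c) (i, c) + (N : ℂ)⁻¹ * ∑ d : Fin 2, coupling τ c d *
          (R (X ω) (j, c) (j, d) * S (X ω) (i, d) (i, c))) * Y (X ω) =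
          u ω * S (X ω) (j, c) (i, c) * Y (X ω) +
            ∑ d : Fin 2, (r : ℂ) ^ 2 * coupling τ c d * G d (X ω) := by
        rw [hNc, add_mul, Finset.mul_sum, Finset.sum_mul]
        congr 1
        refine Finset.sum_congr rfl fun d _ => ?_
        simp only [hG]; ring
      simp only [h3]
      rw [integral_add i0 (integrable_finsetSum _ fun d _ => (iG d).const_mul _),
        integral_finsetSum _ fun d _ => (iG d).const_mul _]
      simp only [integral_const_mul]
    rw [h2, hrem2]
    simp only [Fin.sum_univ_two]
    ring
  change ‖∫ ω, (u ω * S (X ω) (j, c) (i, c) + (N : ℂ)⁻¹ * ∑ d : Fin 2, coupling τ c d *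
        (R (X ω) (j, c) (j, d) * S (X ω) (i, d) (i, c))) * Y (X ω) ∂P‖ ≤ _
  rw [etot]
  have n1 (d) : ‖(∫ ω, u ω * v1 d ω ∂P) * ∫ ω, F d (X' ω) ∂P‖ ≤ r ^ 2 *
      (4 * ∫ ω, ‖R (X ω) (j, c) (i, d)‖ * ‖S (X ω) (j, d) (i, c)‖ ∂P + 152 * r) := by
    rw [norm_mul]
    refine mul_le_mul (nuv1 d) ?_ (norm_nonneg _) (by positivity)
    have := norm_add_le (∫ ω, F d (X ω) ∂P) (∫ ω, F d (X' ω) ∂P - ∫ ω, F d (X ω) ∂P)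
    rw [add_sub_cancel] at this
    linarith [nF d, nF2 d]
  have n2 (d) : ‖(r : ℂ) ^ 2 * coupling τ c d *
      (∫ ω, G d (X' ω) ∂P - ∫ ω, G d (X ω) ∂P)‖ ≤ r ^ 2 * 1 * (152 * r) := by
    rw [norm_mul, norm_mul, norm_pow, Complex.norm_real, Real.norm_of_nonneg hr.le]
    have h1 := norm_coupling_le hτ0 hτ1 c d
    have h2 := nG d
    gcongr
  have n1s := norm_sum_le_of_le Finset.univ fun d (_ : d ∈ Finset.univ) => n1 d
  have n2s := norm_sum_le_of_le Finset.univ fun d (_ : d ∈ Finset.univ) => n2 d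
  refine (norm_sub_le_of_le (norm_sub_le_of_le nrem n1s) n2s).trans ?_
  -- The constant 784 is `176 + 2 * 152 + 2 * 152`: the remainder, and the two returns from `X'` to
  -- `X`, each summed over `d`.
  have hr4 : r ^ 4 ≤ r ^ 3 := pow_le_pow_of_le_one hr.le hr1 (by norm_num)
  simp only [Fin.sum_univ_two]
  linarith

end IsEllipticEnsemble

end SecondMoment

end QuatGreen

namespace QuatGreen

open Matrix
open scoped Matrix.Norms.L2Operator

/-! ### Mean-square bound for the discrepancy -/

namespace IsEllipticEnsemble

variable {Ω : Type*} [MeasurableSpace Ω] {P : Measure Ω} [IsProbabilityMeasure P] {N : ℕ}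
  {X : Ω → Matrix (Fin N) (Fin N) ℂ} {τ r C : ℝ}
  (D : Matrix (Fin N) (Fin N) ℂ) (z : ℂ) {ε : ℝ} {g : ℍ[ℝ]}

lemma norm_summand_le (hNr : (N : ℝ)⁻¹ = r ^ 2) (hε : 1 ≤ ε) (hg : g ∈ closedHalfSpace)
    (hg1 : ‖g‖ ≤ 1) (hτ0 : 0 ≤ τ) (hτ1 : τ ≤ 1) (M : Matrix (Fin N) (Fin N) ℂ) (i j : Fin N)
    (a b c : Fin 2) :
    ‖(bold M (i, c) (j, c) * sideResolvent D z ε τ g a b M (j, c) (i, c) +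
        (N : ℂ)⁻¹ * ∑ d : Fin 2, coupling τ c d * (resolvent (quat z ε) (D + M) (j, c) (j, d) *
            sideResolvent D z ε τ g a b M (i, d) (i, c))) *
        star (discrepancy D z ε τ g M a b)‖ ≤ 4 * (‖M i j‖ + ‖M j i‖) + 8 * r ^ 2 := by
  have bS (x y) : ‖sideResolvent D z ε τ g a b M x y‖ ≤ 1 :=
    (norm_entry_le _ _ _).trans (norm_sideResolvent_le D z hε hg a b M)
  have bR (x y) : ‖resolvent (quat z ε) (D + M) x y‖ ≤ 1 :=
    (norm_entry_le _ _ _).trans (norm_resolvent_le_one z hε _)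
  have bY : ‖star (discrepancy D z ε τ g M a b)‖ ≤ 4 := by
    rw [norm_star]
    exact (norm_entry_le _ _ _).trans (norm_discrepancy_le D z hε hg hg1 hτ0 hτ1 M)
  have h1 : ‖bold M (i, c) (j, c) * sideResolvent D z ε τ g a b M (j, c) (i, c)‖ ≤
      ‖M i j‖ + ‖M j i‖ := by
    rw [norm_mul]
    exact (mul_le_of_le_one_right (norm_nonneg _) (bS _ _)).trans (norm_bold_le M i j c)
  have h2 (d : Fin 2) : ‖coupling τ c d * (resolvent (quat z ε) (D + M) (j, c) (j, d) *
      sideResolvent D z ε τ g a b M (i, d) (i, c))‖ ≤ 1 := by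
    rw [norm_mul, norm_mul]
    exact mul_le_one₀ (norm_coupling_le hτ0 hτ1 c d) (by positivity)
      (mul_le_one₀ (bR _ _) (norm_nonneg _) (bS _ _))
  have h3 := norm_sum_le_of_le Finset.univ fun d (_ : d ∈ Finset.univ) => h2 d
  have h4 : ‖(N : ℂ)⁻¹ * ∑ d : Fin 2, coupling τ c d *
      (resolvent (quat z ε) (D + M) (j, c) (j, d) *
      sideResolvent D z ε τ g a b M (i, d) (i, c))‖ ≤ r ^ 2 * 2 := by
    rw [norm_mul, norm_inv, Complex.norm_natCast, hNr]
    refine mul_le_mul_of_nonneg_left (h3.trans_eq (by simp)) (by positivity)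
  rw [norm_mul]
  refine (mul_le_mul (norm_add_le_of_le h1 h4) bY (norm_nonneg _) (by positivity)).trans
    (le_of_eq (by ring))

omit [IsProbabilityMeasure P] in
lemma nonneg_const (hX : IsEllipticEnsemble P X τ r C) (hr : 0 < r) (i : Fin N) : 0 ≤ C := by
  have h : 0 ≤ C * r ^ 3 :=
    (integral_nonneg fun ω => by positivity).trans (hX.integral_cube i i)
  exact nonneg_of_mul_nonneg_left h (by positivity)

/-- The discrepancy is small in mean square. -/
lemma integral_norm_sq_discrepancy_le (hX : IsEllipticEnsemble P X τ r C) (hr : 0 < r)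
    (hNr : (N : ℝ)⁻¹ = r ^ 2) (hε : 1 ≤ ε) (hg : g ∈ closedHalfSpace) (hg1 : ‖g‖ ≤ 1)
    (hτ0 : 0 ≤ τ) (hτ1 : τ ≤ 1) (a b : Fin 2) :
    ∫ ω, ‖discrepancy D z ε τ g (X ω) a b‖ ^ 2 ∂P ≤ (1608 + 1024 * C) * r := by
  have hε0 : 0 < ε := by linarith
  have hN : N ≠ 0 := by
    rintro rfl
    simp only [Nat.cast_zero, _root_.inv_zero] at hNr
    exact (pow_pos hr 2).ne hNr
  have hNpos : (0 : ℝ) < N := by exact_mod_cast Nat.pos_of_ne_zero hN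
  have hNr' : (N : ℝ) * r ^ 2 = 1 := by rw [← hNr, mul_inv_cancel₀ hNpos.ne']
  have hr1 : r ≤ 1 := by
    have : (1 : ℝ) ≤ N := by exact_mod_cast Nat.one_le_iff_ne_zero.2 hN
    by_contra! h
    nlinarith
  have hC : 0 ≤ C := hX.nonneg_const hr ⟨0, Nat.pos_of_ne_zero hN⟩
  set S := sideResolvent D z ε τ g a b with hS
  set R : Matrix (Fin N) (Fin N) ℂ → _ := fun M => resolvent (quat z ε) (D + M) with hR
  set Y : Matrix (Fin N) (Fin N) ℂ → ℂ := fun M => star (discrepancy D z ε τ g M a b) with hY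
  set W : Fin N → Fin N → Fin 2 → Matrix (Fin N) (Fin N) ℂ → ℂ := fun i j c M =>
    (bold M (i, c) (j, c) * S M (j, c) (i, c) + (N : ℂ)⁻¹ * ∑ d : Fin 2, coupling τ c d *
      (R M (j, c) (j, d) * S M (i, d) (i, c))) * Y M with hW
  have cS (x y) : Continuous fun M => S M x y := continuous_sideResolvent_entry D z hε0 τ g a b x y
  have cR (x y) : Continuous fun M => R M x y := continuous_resolvent_entry D z hε0 x y
  have cY : Continuous Y := (continuous_discrepancy D z hε0 τ g a b).star
  have cW (i j c) : Continuous (W i j c) :=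
    (((continuous_bold.matrix_elem _ _).mul (cS _ _)).add (continuous_const.mul
      (continuous_finsetSum _ fun d _ => continuous_const.mul ((cR _ _).mul (cS _ _))))).mul cY
  have bW (i j c M) : ‖W i j c M‖ ≤ 4 * (‖M i j‖ + ‖M j i‖) + 8 * r ^ 2 :=
    norm_summand_le D z hNr hε hg hg1 hτ0 hτ1 M i j a b c
  have ih (i j) : Integrable (fun ω => 4 * (‖X ω i j‖ + ‖X ω j i‖) + 8 * r ^ 2) P :=
    (((hX.integral_pow_sum_le hr i j).1.1).const_mul 4).add (integrable_const _)
  have iW (i j c) : Integrable (fun ω => W i j c (X ω)) P :=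
    (ih i j).mono' (hX.measurable_comp (cW i j c)).aestronglyMeasurable
      (ae_of_all _ fun ω => bW i j c (X ω))
  set V : Fin N → Fin N → Fin 2 → Fin 2 → ℝ := fun i j c d =>
    ∫ ω, ‖R (X ω) (j, c) (i, d)‖ * ‖S (X ω) (j, d) (i, c)‖ ∂P with hV
  have V0 (i j c d) : 0 ≤ V i j c d := integral_nonneg fun ω => by positivity
  -- Diagonal terms need no cancellation: there are only `2N` of them, each at most `8 r + 8 r² ≤ 16
  -- r`.
  have nW (i j c) : ‖∫ ω, W i j c (X ω) ∂P‖ ≤ (784 + 512 * C) * r ^ 3 +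
      (if i = j then 16 * r else 0) + 4 * r ^ 2 * ∑ d : Fin 2, V i j c d := by
    by_cases hij : i = j
    · subst hij
      have h1 : ‖∫ ω, W i i c (X ω) ∂P‖ ≤ ∫ ω, (4 * (‖X ω i i‖ + ‖X ω i i‖) + 8 * r ^ 2) ∂P :=
        norm_integral_le_of_norm_le (ih i i) (ae_of_all _ fun ω => bW i i c (X ω))
      obtain ⟨⟨ih1, eh1⟩, -⟩ := hX.integral_pow_sum_le hr i i
      rw [integral_add (ih1.const_mul 4) (integrable_const _), integral_const_mul] at h1
      simp only [integral_const, probReal_univ, one_smul] at h1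
      have h2 : 0 ≤ 4 * r ^ 2 * ∑ d : Fin 2, V i i c d :=
        mul_nonneg (by positivity) (Finset.sum_nonneg fun d _ => V0 i i c d)
      have h3 : 0 ≤ (784 + 512 * C) * r ^ 3 := by positivity
      have h4 : r ^ 2 ≤ r := by nlinarith
      rw [if_pos rfl]
      linarith
    · rw [if_neg hij, add_zero]
      exact hX.norm_integral_offDiag_le D z hr hr1 hNr hε hg hg1 hτ0 hτ1 hij a b c
  have etot : ((N * ∫ ω, ‖discrepancy D z ε τ g (X ω) a b‖ ^ 2 ∂P : ℝ) : ℂ) =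
      ∑ i, ∑ j, ∑ c, ∫ ω, W i j c (X ω) ∂P := by
    have h1 : ∫ ω, ∑ i, ∑ j, ∑ c, W i j c (X ω) ∂P = ∑ i, ∑ j, ∑ c, ∫ ω, W i j c (X ω) ∂P := by
      rw [integral_finsetSum _ fun i _ => integrable_finsetSum _ fun j _ =>
        integrable_finsetSum _ fun c _ => iW i j c]
      refine Finset.sum_congr rfl fun i _ => ?_
      rw [integral_finsetSum _ fun j _ => integrable_finsetSum _ fun c _ => iW i j c]
      refine Finset.sum_congr rfl fun j _ => ?_
      rw [integral_finsetSum _ fun c _ => iW i j c]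
    rw [← h1, ← integral_const_mul]
    refine integral_ofReal.symm.trans (integral_congr_ae (ae_of_all _ fun ω => ?_))
    beta_reduce
    have h2 := natCast_mul_discrepancy (τ := τ) (g := g) D z hε0 hN a b (X ω)
    have h3 : ∑ i, ∑ j, ∑ c, W i j c (X ω) =
        (N : ℂ) * discrepancy D z ε τ g (X ω) a b * Y (X ω) := by
      rw [h2]
      simp only [hW, Finset.sum_mul]
      rfl
    rw [h3, mul_assoc]
    change _ = (N : ℂ) * (discrepancy D z ε τ g (X ω) a b *
      (starRingEnd ℂ) (discrepancy D z ε τ g (X ω) a b))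
    rw [Complex.mul_conj']
    push_cast
    rfl
  have iV (i j c d) : Integrable (fun ω => ‖R (X ω) (j, c) (i, d)‖ * ‖S (X ω) (j, d) (i, c)‖) P := by
    have h1 : Integrable (fun ω => R (X ω) (j, c) (i, d) * S (X ω) (j, d) (i, c)) P :=
      integrable_of_bounded (hX.measurable_comp ((cR (j, c) (i, d)).mul (cS (j, d) (i, c)))) 1
        fun ω => (norm_mul_le _ _).trans (mul_le_one₀
          ((norm_entry_le _ _ _).trans (norm_resolvent_le_one z hε _)) (norm_nonneg _)
          ((norm_entry_le _ _ _).trans (norm_sideResolvent_le D z hε hg a b _)))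
    exact h1.norm.congr (ae_of_all _ fun ω => norm_mul _ _)
  have sV : ∑ i, ∑ j, ∑ c, ∑ d, V i j c d ≤ 2 * N := by
    have h1 : ∑ i, ∑ j, ∑ c, ∑ d, V i j c d = ∫ ω, ∑ i : Fin N, ∑ j : Fin N, ∑ c : Fin 2,
        ∑ d : Fin 2, ‖R (X ω) (j, c) (i, d)‖ * ‖S (X ω) (j, d) (i, c)‖ ∂P := by
      rw [integral_finsetSum _ fun i _ => integrable_finsetSum _ fun j _ =>
        integrable_finsetSum _ fun c _ => integrable_finsetSum _ fun d _ => iV i j c d]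
      refine Finset.sum_congr rfl fun i _ => ?_
      rw [integral_finsetSum _ fun j _ => integrable_finsetSum _ fun c _ =>
        integrable_finsetSum _ fun d _ => iV i j c d]
      refine Finset.sum_congr rfl fun j _ => ?_
      rw [integral_finsetSum _ fun c _ => integrable_finsetSum _ fun d _ => iV i j c d]
      refine Finset.sum_congr rfl fun c _ => ?_
      rw [integral_finsetSum _ fun d _ => iV i j c d]
    rw [h1]
    have h2 : ∫ ω, ∑ i : Fin N, ∑ j : Fin N, ∑ c : Fin 2,
        ∑ d : Fin 2, ‖R (X ω) (j, c) (i, d)‖ * ‖S (X ω) (j, d) (i, c)‖ ∂P ≤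
        ∫ _, (2 * N : ℝ) ∂P := by
      refine integral_mono (integrable_finsetSum _ fun i _ => integrable_finsetSum _ fun j _ =>
        integrable_finsetSum _ fun c _ => integrable_finsetSum _ fun d _ => iV i j c d)
        (integrable_const _) fun ω => ?_
      exact sum_norm_mul_norm_le (norm_resolvent_le_one z hε _)
        (norm_sideResolvent_le D z hε hg a b _)
    simpa using h2
  have hbound : N * ∫ ω, ‖discrepancy D z ε τ g (X ω) a b‖ ^ 2 ∂P ≤
      ∑ i, ∑ j, ∑ c, ((784 + 512 * C) * r ^ 3 + (if i = j then 16 * r else 0) +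
        4 * r ^ 2 * ∑ d : Fin 2, V i j c d) := by
    have h0 : 0 ≤ N * ∫ ω, ‖discrepancy D z ε τ g (X ω) a b‖ ^ 2 ∂P :=
      mul_nonneg hNpos.le (integral_nonneg fun ω => by positivity)
    have h1 := congrArg norm etot
    rw [Complex.norm_real, Real.norm_of_nonneg h0] at h1
    rw [h1]
    exact norm_sum_le_of_le _ fun i _ => norm_sum_le_of_le _ fun j _ =>
      norm_sum_le_of_le _ fun c _ => nW i j c
  have esum : ∑ i : Fin N, ∑ j : Fin N, ∑ c : Fin 2, ((784 + 512 * C) * r ^ 3 +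
        (if i = j then 16 * r else 0) + 4 * r ^ 2 * ∑ d : Fin 2, V i j c d) =
      2 * N ^ 2 * ((784 + 512 * C) * r ^ 3) + 2 * N * (16 * r) +
        4 * r ^ 2 * ∑ i, ∑ j, ∑ c, ∑ d, V i j c d := by
    simp only [Finset.sum_add_distrib, Finset.mul_sum, Finset.sum_const, Finset.card_univ,
      Fintype.card_fin, nsmul_eq_mul]
    simp
    ring
  rw [esum] at hbound
  have h5 : 4 * r ^ 2 * ∑ i, ∑ j, ∑ c, ∑ d, V i j c d ≤ 4 * r ^ 2 * (2 * N) :=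
    mul_le_mul_of_nonneg_left sV (by positivity)
  have h6 : 4 * r ^ 2 * (2 * N) = 8 := by linear_combination 8 * hNr'
  have h7 : 2 * (N : ℝ) ^ 2 * ((784 + 512 * C) * r ^ 3) = N * (2 * (784 + 512 * C) * r) := by
    linear_combination (2 * N * (784 + 512 * C) * r) * hNr'
  -- With `N r² = 1` the three sums are at most `N r` times `1568 + 1024 C`, `32` and `8`, which add
  -- up to the stated constant.
  have h8 : 1 ≤ N * r := by
    have : (N : ℝ) * r ^ 2 ≤ N * r := mul_le_mul_of_nonneg_left (by nlinarith) hNpos.le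
    linarith
  refine le_of_mul_le_mul_left (hbound.trans ?_) hNpos
  linarith

end IsEllipticEnsemble

/-! ### The normalised array is an elliptic ensemble -/

section Array

variable {Ω : Type*} [MeasurableSpace Ω] {P : Measure Ω}

/-- Each transposed pair of entries is independent of the matrix from which it is removed. -/
lemma indepFun_removePair {ξ : ℕ → ℕ → Ω → ℂ} (hξ : ∀ i j, Measurable (ξ i j))
    (hindep : iIndepFun (fun (p : {p : ℕ × ℕ // p.1 ≤ p.2}) (ω : Ω) =>
        (ξ p.1.1 p.1.2 ω, ξ p.1.2 p.1.1 ω)) P) {N : ℕ} (i j : Fin N) :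
    IndepFun (γ := Fin N → Fin N → ℂ)
      (fun ω => (normalised N (fun i j => ξ i j ω) i j, normalised N (fun i j => ξ i j ω) j i))
      (fun ω => removePair i j (normalised N (fun i j => ξ i j ω))) P := by
  set m : {p : ℕ × ℕ // p.1 ≤ p.2} → MeasurableSpace Ω := fun p =>
    MeasurableSpace.comap (fun ω => (ξ p.1.1 p.1.2 ω, ξ p.1.2 p.1.1 ω)) inferInstance with hm
  -- Each position is assigned to its unordered pair. The deleted matrix uses only the σ-algebras of
  -- the other pairs, and disjoint families of independent σ-algebras generate independent ones.
  let pr (k l : ℕ) : {p : ℕ × ℕ // p.1 ≤ p.2} := ⟨(min k l, max k l), min_le_max⟩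
  have hmeas (k l : ℕ) : Measurable[m (pr k l)] (ξ k l) := by
    have h1 : Measurable[m (pr k l)] fun ω =>
        (ξ (min k l) (max k l) ω, ξ (max k l) (min k l) ω) := comap_measurable _
    rcases le_total k l with h | h
    · have := measurable_fst.comp h1
      simpa [Function.comp_def, min_eq_left h, max_eq_right h] using this
    · have := measurable_snd.comp h1
      simpa [Function.comp_def, min_eq_right h, max_eq_left h] using this
  have hle (p) : m p ≤ ‹MeasurableSpace Ω› :=
    ((hξ _ _).prodMk (hξ _ _)).comap_le
  have hI : iIndep m P := (iIndepFun_iff_iIndep _ _ _).1 hindep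
  have h := indep_iSup_of_disjoint hle hI
    (S := {pr i j}) (T := {pr i j}ᶜ) disjoint_compl_right
  refine (IndepFun_iff_Indep _ _ _).2 ?_
  refine indep_of_indep_of_le h ?_ ?_
  · refine Measurable.comap_le ?_
    have hle1 : m (pr i j) ≤ ⨆ p ∈ ({pr i j} : Set _), m p :=
      le_iSup₂_of_le (pr i j) rfl le_rfl
    have e : pr j i = pr i j := Subtype.ext (Prod.ext (min_comm _ _) (max_comm _ _))
    have h1 := (hmeas i j).mono hle1 le_rfl
    have h2 := ((e ▸ hmeas j i : Measurable[m (pr i j)] (ξ j i))).mono hle1 le_rfl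
    exact (h1.div_const _).prodMk (h2.div_const _)
  · refine Measurable.comap_le ?_
    refine @measurable_pi_lambda _ _ _ (_) _ _ fun k => @measurable_pi_lambda _ _ _ (_) _ _ fun l => ?_
    by_cases hkl : (k = i ∧ l = j) ∨ (k = j ∧ l = i)
    · simp only [removePair, Matrix.of_apply, if_pos hkl]
      exact measurable_const
    · simp only [removePair, Matrix.of_apply, if_neg hkl, normalised]
      have hne : pr k l ∈ ({pr i j}ᶜ : Set _) := by
        intro heq
        have h1 : min (k : ℕ) l = min (i : ℕ) j := congrArg (fun p => p.1.1) heq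
        have h2 : max (k : ℕ) l = max (i : ℕ) j := congrArg (fun p => p.1.2) heq
        apply hkl
        simp only [Fin.ext_iff]
        omega
      exact ((hmeas k l).mono (le_iSup₂_of_le (pr k l) hne le_rfl) le_rfl).div_const _

lemma isEllipticEnsemble_normalised
    {ξ : ℕ → ℕ → Ω → ℂ} (hξ : ∀ i j, Measurable (ξ i j))
    (hmean : ∀ i j, ∫ ω, ξ i j ω ∂P = 0) (hvar : ∀ i j, ∫ ω, ‖ξ i j ω‖ ^ 2 ∂P = 1) {C : ℝ}
    (hthird : ∀ i j,
      Integrable (fun ω => ‖ξ i j ω‖ ^ 3) P ∧ ∫ ω, ‖ξ i j ω‖ ^ 3 ∂P < C)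
    (hindep : iIndepFun (fun (p : {p : ℕ × ℕ // p.1 ≤ p.2}) (ω : Ω) =>
        (ξ p.1.1 p.1.2 ω, ξ p.1.2 p.1.1 ω)) P) {τ : ℝ}
    (hcov : ∀ i j, i ≠ j → ∫ ω, ξ i j ω * ξ j i ω ∂P = (τ : ℂ)) (N : ℕ) :
    IsEllipticEnsemble P (fun ω => normalised N (fun i j => ξ i j ω)) τ (√N)⁻¹ C := by
  have hnorm (i j : Fin N) (ω : Ω) :
      ‖normalised N (fun i j => ξ i j ω) i j‖ = (√N)⁻¹ * ‖ξ i j ω‖ := by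
    rw [normalised, Matrix.of_apply, norm_div, Complex.norm_real,
      Real.norm_of_nonneg (Real.sqrt_nonneg _), div_eq_inv_mul]
  have hsq (i j : ℕ) : Integrable (fun ω => ‖ξ i j ω‖ ^ 2) P := by
    -- A non-integrable function has Bochner integral zero, which contradicts unit variance.
    by_contra h
    have := hvar i j
    rw [integral_undef h] at this
    exact zero_ne_one this
  refine ⟨fun i j => (hξ i j).div_const _, fun i j => ?_, fun i j => ?_, fun i j => ?_,
    fun i j => ?_, fun i j => ?_, fun i j hij => ?_, fun i j _ => indepFun_removePair hξ hindep i j⟩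
  · simp only [normalised, Matrix.of_apply]
    rw [integral_div, hmean, zero_div]
  · simp only [hnorm, mul_pow]
    exact (hsq i j).const_mul _
  · simp only [hnorm, mul_pow]
    rw [integral_const_mul, hvar, mul_one]
  · simp only [hnorm, mul_pow]
    exact (hthird i j).1.const_mul _
  · simp only [hnorm, mul_pow]
    rw [integral_const_mul, mul_comm]
    exact mul_le_mul_of_nonneg_right (hthird i j).2.le (by positivity)
  · simp only [normalised, Matrix.of_apply, div_mul_div_comm]
    rw [integral_div, hcov i j (fun h => hij (Fin.ext h))]
    push_cast
    field_simp

end Array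

end QuatGreen

namespace QuatGreen

/-! ### Convergence in probability -/

section Convergence

open scoped Matrix.Norms.L2Operator

variable {Ω : Type*} [MeasurableSpace Ω] {P : Measure Ω} [IsProbabilityMeasure P]

lemma norm_sq_le_four_mul_sum (B : Matrix (Fin 2) (Fin 2) ℂ) :
    ‖B‖ ^ 2 ≤ 4 * ∑ a, ∑ b, ‖B a b‖ ^ 2 := by
  have h := pow_le_pow_left₀ (norm_nonneg _) (norm_le_sum_entries B) 2
  refine h.trans ?_
  simp only [Fin.sum_univ_two]
  nlinarith [sq_nonneg (‖B 0 0‖ - ‖B 0 1‖), sq_nonneg (‖B 0 0‖ - ‖B 1 0‖),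
    sq_nonneg (‖B 0 0‖ - ‖B 1 1‖), sq_nonneg (‖B 0 1‖ - ‖B 1 0‖),
    sq_nonneg (‖B 0 1‖ - ‖B 1 1‖), sq_nonneg (‖B 1 0‖ - ‖B 1 1‖)]

/-- The discrepancy exceeds a given threshold with small probability. -/
lemma IsEllipticEnsemble.measureReal_discrepancy_le {N : ℕ} {X : Ω → Matrix (Fin N) (Fin N) ℂ}
    {τ r C : ℝ} (hX : IsEllipticEnsemble P X τ r C) (D : Matrix (Fin N) (Fin N) ℂ) (z : ℂ)
    {ε : ℝ} {g : ℍ[ℝ]} (hr : 0 < r)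
    (hNr : (N : ℝ)⁻¹ = r ^ 2) (hε : 1 ≤ ε) (hg : g ∈ closedHalfSpace) (hg1 : ‖g‖ ≤ 1)
    (hτ0 : 0 ≤ τ) (hτ1 : τ ≤ 1) {η : ℝ} (hη : 0 < η) :
    P.real {ω | η ≤ ‖discrepancy D z ε τ g (X ω)‖} ≤ 16 * (1608 + 1024 * C) * r / η ^ 2 := by
  have hε0 : 0 < ε := by linarith
  have i1 (a b) : Integrable (fun ω => ‖discrepancy D z ε τ g (X ω) a b‖ ^ 2) P := by
    refine (integrable_const ((4 : ℝ) ^ 2)).mono' ((hX.measurable_comp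
      (continuous_discrepancy D z hε0 τ g a b)).norm.pow_const 2).aestronglyMeasurable
      (ae_of_all _ fun ω => ?_)
    rw [Real.norm_of_nonneg (by positivity)]
    exact pow_le_pow_left₀ (norm_nonneg _)
      ((norm_entry_le _ _ _).trans (norm_discrepancy_le D z hε hg hg1 hτ0 hτ1 _)) 2
  set f : Ω → ℝ := fun ω => ∑ a, ∑ b, ‖discrepancy D z ε τ g (X ω) a b‖ ^ 2 with hf
  have i2 : Integrable f P :=
    integrable_finsetSum _ fun a _ => integrable_finsetSum _ fun b _ => i1 a b
  have hint : ∫ ω, f ω ∂P ≤ 4 * ((1608 + 1024 * C) * r) := by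
    have h1 : ∫ ω, f ω ∂P = ∑ a, ∑ b, ∫ ω, ‖discrepancy D z ε τ g (X ω) a b‖ ^ 2 ∂P := by
      rw [hf, integral_finsetSum _ fun a _ => integrable_finsetSum _ fun b _ => i1 a b]
      refine Finset.sum_congr rfl fun a _ => ?_
      rw [integral_finsetSum _ fun b _ => i1 a b]
    have h2 (a b) := hX.integral_norm_sq_discrepancy_le D z hr hNr hε hg hg1 hτ0 hτ1 a b
    rw [h1]
    simp only [Fin.sum_univ_two]
    linarith [h2 0 0, h2 0 1, h2 1 0, h2 1 1]
  -- The threshold `η ^ 2 / 4` reflects `‖B‖ ^ 2 ≤ 4 f`; with the four entries in `f` it produces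
  -- the factor 16.
  have hmarkov := mul_meas_ge_le_integral_of_nonneg (μ := P) (f := f)
    (ae_of_all _ fun ω => by simp only [hf, Pi.zero_apply]; positivity) i2 (η ^ 2 / 4)
  have hsub : {ω | η ≤ ‖discrepancy D z ε τ g (X ω)‖} ⊆ {ω | η ^ 2 / 4 ≤ f ω} := by
    intro ω hω
    have h1 := pow_le_pow_left₀ hη.le (show η ≤ _ from hω) 2
    have h2 := norm_sq_le_four_mul_sum (discrepancy D z ε τ g (X ω))
    change η ^ 2 / 4 ≤ ∑ a, ∑ b, ‖discrepancy D z ε τ g (X ω) a b‖ ^ 2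
    linarith
  have hmono : P.real {ω | η ≤ ‖discrepancy D z ε τ g (X ω)‖} ≤ P.real {ω | η ^ 2 / 4 ≤ f ω} :=
    measureReal_mono hsub
  rw [le_div_iff₀ (by positivity)]
  nlinarith [mul_le_mul_of_nonneg_left hmono (by positivity : 0 ≤ η ^ 2 / 4)]

/-- Convergence in probability of the Green's functions of the perturbed matrices. -/
lemma tendstoInMeasure_green {D : (N : ℕ) → Matrix (Fin N) (Fin N) ℂ}
    {X : (N : ℕ) → Ω → Matrix (Fin N) (Fin N) ℂ} {τ C : ℝ}
    (hX : ∀ N, IsEllipticEnsemble P (X N) τ (√N)⁻¹ C) (z : ℂ) {ε : ℝ} (hε : 1 < ε)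
    (hτ0 : 0 ≤ τ) (hτ1 : τ ≤ 1) {g : ℍ[ℝ]} (hg : g ∈ closedHalfSpace) (hg1 : ‖g‖ ≤ 1)
    (hlim : Tendsto (fun N => green (shiftPoint z ε τ g) (D N)) atTop (𝓝 g)) :
    TendstoInMeasure P (fun N ω => green (quat z ε) (D N + X N ω)) atTop (fun _ => g) := by
  have hε0 : 0 < ε := by linarith
  rw [tendstoInMeasure_iff_measureReal_norm]
  intro δ hδ
  have hκ : 0 < 1 - 1 / ε ^ 2 := by
    rw [sub_pos, div_lt_one (by positivity)]; nlinarith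
  -- Half of the stability margin goes to the deterministic error, so a deviation of `δ` forces the
  -- discrepancy to be at least `η`.
  set η := (1 - 1 / ε ^ 2) * δ / 2 with hη
  have hη0 : 0 < η := by positivity
  have hr : Tendsto (fun N : ℕ => (√(N : ℝ))⁻¹) atTop (𝓝 0) :=
    tendsto_inv_atTop_zero.comp (Real.tendsto_sqrt_atTop.comp tendsto_natCast_atTop_atTop)
  have hbd : Tendsto (fun N : ℕ => 16 * (1608 + 1024 * C) * (√(N : ℝ))⁻¹ / η ^ 2) atTop (𝓝 0) := by
    simpa using (hr.const_mul (16 * (1608 + 1024 * C))).div_const (η ^ 2)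
  refine tendsto_of_tendsto_of_tendsto_of_le_of_le' tendsto_const_nhds hbd
    (Eventually.of_forall fun _ => measureReal_nonneg) ?_
  have hev : ∀ᶠ N in atTop, ‖green (shiftPoint z ε τ g) (D N) - g‖ < η :=
    (tendsto_iff_norm_sub_tendsto_zero.1 hlim).eventually_lt_const hη0
  filter_upwards [hev, eventually_gt_atTop 0] with N hN hN0
  have hN0' : (0 : ℝ) < N := by exact_mod_cast hN0
  refine le_trans (measureReal_mono fun ω hω => ?_)
    ((hX N).measureReal_discrepancy_le (D N) z (by positivity) ?_ hε.le hg hg1 hτ0 hτ1 hη0)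
  · have h1 := norm_green_sub_le (D N) z hε0 hg hτ0 hτ1 (X N ω)
    have h2 : (1 - 1 / ε ^ 2) * δ ≤ (1 - 1 / ε ^ 2) * ‖green (quat z ε) (D N + X N ω) - g‖ :=
      mul_le_mul_of_nonneg_left hω hκ.le
    change η ≤ ‖discrepancy (D N) z ε τ g (X N ω)‖
    linarith
  · rw [inv_pow, Real.sq_sqrt hN0'.le]

end Convergence

end QuatGreen

/-! ### The sum rule -/

theorem theorem2
    {Ω : Type*} [MeasurableSpace Ω] (P : Measure Ω) [IsProbabilityMeasure P]
    -- the infinite array of complex random variables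
    (ξ : ℕ → ℕ → Ω → ℂ) (hξ : ∀ i j, Measurable (ξ i j))
    -- centred, of unit variance, with bounded third absolute moments
    (hmean : ∀ i j, ∫ ω, ξ i j ω ∂P = 0)
    (hvar : ∀ i j, ∫ ω, ‖ξ i j ω‖ ^ 2 ∂P = 1)
    (hthird : ∃ C : ℝ, ∀ i j,
      Integrable (fun ω => ‖ξ i j ω‖ ^ 3) P ∧ ∫ ω, ‖ξ i j ω‖ ^ 3 ∂P < C)
    -- independent, up to the correlation of transposed entries
    (hindep : iIndepFun
      (fun (p : {p : ℕ × ℕ // p.1 ≤ p.2}) (ω : Ω) =>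
        (ξ p.1.1 p.1.2 ω, ξ p.1.2 p.1.1 ω)) P)
    (τ : ℝ) (hτ0 : 0 ≤ τ) (hτ1 : τ ≤ 1)
    (hcov : ∀ i j, i ≠ j → ∫ ω, ξ i j ω * ξ j i ω ∂P = (τ : ℂ))
    -- deterministic matrices whose Green's functions converge pointwise
    (D : (N : ℕ) → Matrix (Fin N) (Fin N) ℂ)
    (GD : ℍ[ℝ] → ℍ[ℝ])
    (hD : ∀ p ∈ QuatGreen.halfSpace,
      Tendsto (fun N => QuatGreen.green p (D N)) atTop (𝓝 (GD p)))
    (z : ℂ) (ε : ℝ) (hε : 1 < ε) :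
    ∃ g : ℍ[ℝ],
      (QuatGreen.quat z ε + QuatGreen.elemMul (QuatGreen.quat τ 1) g ∈ QuatGreen.halfSpace ∧
        g = GD (QuatGreen.quat z ε + QuatGreen.elemMul (QuatGreen.quat τ 1) g)) ∧
      (∀ g' : ℍ[ℝ],
        QuatGreen.quat z ε + QuatGreen.elemMul (QuatGreen.quat τ 1) g' ∈ QuatGreen.halfSpace →
        g' = GD (QuatGreen.quat z ε + QuatGreen.elemMul (QuatGreen.quat τ 1) g') → g' = g) ∧
      TendstoInMeasure P
        (fun (N : ℕ) (ω : Ω) =>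
          QuatGreen.green (QuatGreen.quat z ε)
            (D N + QuatGreen.normalised N (fun i j => ξ i j ω)))
        atTop (fun _ => g) := by

  obtain ⟨C, hC⟩ := hthird
  obtain ⟨g, hg, hfix, huniq⟩ := QuatGreen.exists_unique_selfConsistent hD z hε hτ0 hτ1
  have hε0 : 0 < ε := by linarith
  have hmem := QuatGreen.shiftPoint_mem_halfSpace z hε0 τ hg
  have hlim := hD _ hmem
  rw [← hfix] at hlim
  -- The solution is a limit of Green's functions at a point with j-part at least `ε > 1`, and these
  -- have norm at most one.
  have hg1 : ‖g‖ ≤ 1 := by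
    refine le_of_tendsto hlim.norm (Eventually.of_forall fun N => ?_)
    rw [QuatGreen.shiftPoint_eq z ε τ hg]
    have h1 : 1 ≤ ε + g.imJ := by linarith [hg.1]
    exact (QuatGreen.norm_green_le _ (by linarith) _).trans ((div_le_one (by linarith)).2 h1)
  exact ⟨g, ⟨hmem, hfix⟩, huniq, QuatGreen.tendstoInMeasure_green
    (fun N => QuatGreen.isEllipticEnsemble_normalised hξ hmean hvar hC hindep hcov N)
    z hε hτ0 hτ1 hg hg1 hlim⟩
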